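/- Let $c_{44},R_3,K_2,\rho,\omega\in\mathbb R$ with $c_{44}>0$, $K_2>0$, $c_{44}K_2-R_3^2>0$, $\rho>0$, $\omega>0$, and put $$\mathbf C=\begin{pmatrix}c_{44}&R_3\\R_3&K_2\end{pmatrix},\qquad a_{1,2}=\tfrac12\Big[\operatorname{Tr}\mathbf C\pm\sqrt{(\operatorname{Tr}\mathbf C)^2-4\det\mathbf C}\Big],\qquad \mathbf Q(\psi)=\begin{pmatrix}\cos\psi&-\sin\psi\\\sin\psi&\cos\psi\end{pmatrix}.$$ **(a)** $\mathbf C$ is positive definite and $a_1,a_2>0$. If $R_3\ne0$ and $\psi=\arccos\frac{R_3}{\sqrt{(c_{44}-a_1)^2+R_3^2}}$, then $\mathbf Q(\psi)^{-1}\mathbf C\,\mathbf Q(\psi)=\operatorname{diag}(a_1,a_2)$; if $R_3=0$, then $\mathbf Q(0)^{-1}\mathbf C\,\mathbf Q(0)=\operatorname{diag}(c_{44},K_2)$. **(b)** Let $\psi,a_1,a_2$ now be any real numbers with $\mathbf Q(\psi)^{-1}\mathbf C\,\mathbf Q(\psi)=\operatorname{diag}(a_1,a_2)$. Then $a_1,a_2>0$.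 Let $k_m=\omega\sqrt{\rho/a_m}$ for $m=1,2$, let $\xi\in\mathbb R^2$, and for $x\in\mathbb R^2$ write $r=|x-\xi|$, $r_j=x_j-\xi_j$. With $K_0,K_1$ the modified Bessel functions of the second kind and $H^{(1)}_0$ the Hankel function (principal branches), define $$\mathbf h=\begin{pmatrix}h^u_{31}&h^u_{32}\\h^w_{31}&h^w_{32}\end{pmatrix}=\begin{pmatrix}\frac{\cos\psi}{2\pi a_1}K_0(-ik_1r)&\frac{\sin\psi}{2\pi a_1}K_0(-ik_1r)\\[2pt]\frac{-\sin\psi}{2\pi a_2}K_0(-ik_2r)&\frac{\cos\psi}{2\pi a_2}K_0(-ik_2r)\end{pmatrix},\qquad \mathbf v^*=\begin{pmatrix}u^*_{31}&u^*_{32}\\w^*_{31}&w^*_{32}\end{pmatrix}=\mathbf Q(\psi)\,\mathbf h .$$ 1. $\mathbf v^*$ is locally integrable on $\mathbb R^2$ and is a fundamental solution: $[\mathbf C\Delta+\rho\omega^2\mathbf I_2]\mathbf v^*=-\delta(x-\xi)\mathbf I_2$ in the sense of distributions on $\mathbb R^2$. 2. It is outgoing: each entry $p$ of the $m$-th row of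 $\mathbf Q(\psi)^{-1}\mathbf v^*$ satisfies $\sqrt r\,(\partial_r p-ik_mp)\to0$ as $r\to\infty$, uniformly in the direction. 3. For $x\ne\xi$, the formula for $\mathbf h$ remains true with $\frac1{2\pi a_m}K_0(-ik_mr)$ replaced by $\frac{i}{4a_m}H^{(1)}_0(k_mr)$, $m=1,2$. 4. At every $x\ne\xi$ the entries of $\mathbf h$ and $\mathbf v^*$ are differentiable, and for $j=1,2$ $$\mathbf h_{,j}=\begin{pmatrix}\frac{ik_1\cos\psi}{2\pi a_1}\frac{r_j}{r}K_1(-ik_1r)&\frac{ik_1\sin\psi}{2\pi a_1}\frac{r_j}{r}K_1(-ik_1r)\\[2pt]\frac{-ik_2\sin\psi}{2\pi a_2}\frac{r_j}{r}K_1(-ik_2r)&\frac{ik_2\cos\psi}{2\pi a_2}\frac{r_j}{r}K_1(-ik_2r)\end{pmatrix},\qquad \mathbf v^*_{,j}=\mathbf Q(\psi)\,\mathbf h_{,j},$$ where ${}_{,j}$ denotes $\partial/\partial x_j$. 5. For every $x\neq\xi$, $n=(n_1,n_2)\in\mathbb R^2$ and $i=1,2$, the tractions $t_{3i}=\sum_j\sigma_{3ij}n_j$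 and $G_{3i}=\sum_jH_{3ij}n_j$, where $\sigma_{3ij}=c_{44}u^*_{3i,j}+R_3w^*_{3i,j}$ and $H_{3ij}=R_3u^*_{3i,j}+K_2w^*_{3i,j}$, are given by inserting in these definitions the expressions of item 4 for the entries $u^*_{3i,j}$, $w^*_{3i,j}$ of $\mathbf v^*_{,j}$. -/

import Mathlib

open MeasureTheory Filter Topology
open scoped Matrix

noncomputable section

namespace AntiPlaneQC

/-- The plane `Ox₁x₂`; the coordinates `x₁`, `x₂` are `x 0`, `x 1`. -/
abbrev Plane : Type := EuclideanSpace ℝ (Fin 2)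

/-! ### Bessel functions of orders zero and one (principal branch of the logarithm) -/

/-- `J₀(z) = ∑ (-z²/4)ⁿ / (n!)²`. -/
def besselJ0 (z : ℂ) : ℂ :=
  ∑' n : ℕ, (-(z ^ 2 / 4)) ^ n / ((n.factorial : ℂ) ^ 2)

/-- `Y₀(z) = (2/π) ((log(z/2) + γ) J₀(z) - ∑ Hₙ (-z²/4)ⁿ / (n!)²)`, where `Hₙ` is the `n`-th
harmonic number. -/
def besselY0 (z : ℂ) : ℂ :=
  (2 / (Real.pi : ℂ)) *
    ((Complex.log (z / 2) + (Real.eulerMascheroniConstant : ℂ)) * besselJ0 z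
      - ∑' n : ℕ, ((harmonic n : ℚ) : ℂ) * (-(z ^ 2 / 4)) ^ n / ((n.factorial : ℂ) ^ 2))

/-- The Hankel function of the first kind of order zero, `H₀⁽¹⁾ = J₀ + i Y₀`. -/
def hankelH0 (z : ℂ) : ℂ := besselJ0 z + Complex.I * besselY0 z

/-- `I₀(z) = ∑ (z²/4)ⁿ / (n!)²`. -/
def besselI0 (z : ℂ) : ℂ :=
  ∑' n : ℕ, (z ^ 2 / 4) ^ n / ((n.factorial : ℂ) ^ 2)

/-- `I₁(z) = (z/2) ∑ (z²/4)ⁿ / (n! (n+1)!)`. -/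
def besselI1 (z : ℂ) : ℂ :=
  (z / 2) * ∑' n : ℕ, (z ^ 2 / 4) ^ n / ((n.factorial : ℂ) * ((n + 1).factorial : ℂ))

/-- The modified Bessel function of the second kind of order zero (Macdonald function),
`K₀(z) = -(log(z/2) + γ) I₀(z) + ∑ Hₙ (z²/4)ⁿ / (n!)²`. -/
def besselK0 (z : ℂ) : ℂ :=
  -(Complex.log (z / 2) + (Real.eulerMascheroniConstant : ℂ)) * besselI0 z
    + ∑' n : ℕ, ((harmonic n : ℚ) : ℂ) * (z ^ 2 / 4) ^ n / ((n.factorial : ℂ) ^ 2)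

/-- The modified Bessel function of the second kind of order one,
`K₁(z) = 1/z + log(z/2) I₁(z) - (z/4) ∑ (Hₙ + Hₙ₊₁ - 2γ) (z²/4)ⁿ / (n! (n+1)!)`. -/
def besselK1 (z : ℂ) : ℂ :=
  1 / z + Complex.log (z / 2) * besselI1 z
    - (z / 4) * ∑' n : ℕ,
        (((harmonic n : ℚ) : ℂ) + ((harmonic (n + 1) : ℚ) : ℂ)
            - 2 * (Real.eulerMascheroniConstant : ℂ))
          * (z ^ 2 / 4) ^ n / ((n.factorial : ℂ) * ((n + 1).factorial : ℂ))

/-! ### Material matrix, its eigenvalues, and the rotation -/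

/-- The matrix `C = (c₄₄ R₃; R₃ K₂)` of material constants. -/
def elasticMatrix (c44 R3 K2 : ℝ) : Matrix (Fin 2) (Fin 2) ℝ :=
  !![c44, R3; R3, K2]

/-- `a₁ = ½ (Tr C + √((Tr C)² - 4 det C))`. -/
def eig1 (C : Matrix (Fin 2) (Fin 2) ℝ) : ℝ :=
  (C.trace + √(C.trace ^ 2 - 4 * C.det)) / 2

/-- `a₂ = ½ (Tr C - √((Tr C)² - 4 det C))`. -/
def eig2 (C : Matrix (Fin 2) (Fin 2) ℝ) : ℝ :=
  (C.trace - √(C.trace ^ 2 - 4 * C.det)) / 2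

/-- `ψ = arccos (R₃ / √((c₄₄ - a₁)² + R₃²))`. -/
def rotationAngle (c44 R3 K2 : ℝ) : ℝ :=
  Real.arccos (R3 / √((c44 - eig1 (elasticMatrix c44 R3 K2)) ^ 2 + R3 ^ 2))

/-- The rotation `Q(ψ)`. -/
def rotation (ψ : ℝ) : Matrix (Fin 2) (Fin 2) ℝ :=
  !![Real.cos ψ, -Real.sin ψ; Real.sin ψ, Real.cos ψ]

/-- `Q(ψ)⁻¹ C Q(ψ) = diag(a₁, a₂)`. -/
def Diagonalizes (C : Matrix (Fin 2) (Fin 2) ℝ) (ψ a1 a2 : ℝ) : Prop :=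
  (rotation ψ)⁻¹ * C * rotation ψ = !![a1, 0; 0, a2]

/-- `Q(ψ)` regarded as a complex matrix. -/
def rotationC (ψ : ℝ) : Matrix (Fin 2) (Fin 2) ℂ :=
  (rotation ψ).map Complex.ofReal

/-! ### Fundamental solutions -/

/-- `v` (as a function of `x`, with source point `ξ`) is locally integrable and solves
`[C Δ + ρ ω² I] v = -δ(x - ξ) I₂` in the sense of distributions on the plane. -/
def IsFundamentalSolution (C : Matrix (Fin 2) (Fin 2) ℝ) (ρ ω : ℝ) (ξ : Plane)
    (v : Plane → Matrix (Fin 2) (Fin 2) ℂ) : Prop :=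
  (∀ i j, LocallyIntegrable (fun x => v x i j) volume) ∧
  ∀ φ : Plane → ℂ, ContDiff ℝ (⊤ : ℕ∞) φ → HasCompactSupport φ → ∀ i j : Fin 2,
    (∑ l : Fin 2, (C i l : ℂ) * ∫ x, v x l j * Laplacian.laplacian φ x)
        + (ρ : ℂ) * (ω : ℂ) ^ 2 * ∫ x, v x i j * φ x
      = -(φ ξ) * (1 : Matrix (Fin 2) (Fin 2) ℂ) i j

/-- Sommerfeld's outgoing radiation condition with wave number `k`:
`√r (∂p/∂r - i k p) → 0` as `r = |x - ξ| → ∞`, uniformly in the direction. -/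
def SommerfeldRadiation (k : ℝ) (ξ : Plane) (p : Plane → ℂ) : Prop :=
  Tendsto
    (fun x : Plane => (√(dist x ξ) : ℂ) *
      (fderiv ℝ p x ((dist x ξ)⁻¹ • (x - ξ)) - Complex.I * (k : ℂ) * p x))
    (cocompact Plane) (𝓝 0)

/-- The wave number `k = ω √(ρ / a)`. -/
def waveNumber (ρ ω a : ℝ) : ℝ := ω * √(ρ / a)

/-- The matrix `(cos ψ · p₁, sin ψ · p₁; -sin ψ · p₂, cos ψ · p₂)`. -/
def modalMatrix (ψ : ℝ) (p1 p2 : ℂ) : Matrix (Fin 2) (Fin 2) ℂ :=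
  !![(Real.cos ψ : ℂ) * p1, (Real.sin ψ : ℂ) * p1;
     -(Real.sin ψ : ℂ) * p2, (Real.cos ψ : ℂ) * p2]

/-- `(1 / (2πa)) K₀(-i k r)`. -/
def profileK (ρ ω a r : ℝ) : ℂ :=
  1 / (2 * (Real.pi : ℂ) * (a : ℂ)) * besselK0 (-Complex.I * (waveNumber ρ ω a : ℂ) * (r : ℂ))

/-- `(i / (4a)) H₀⁽¹⁾(k r)`. -/
def profileH (ρ ω a r : ℝ) : ℂ :=
  Complex.I / (4 * (a : ℂ)) * hankelH0 ((waveNumber ρ ω a : ℂ) * (r : ℂ))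

/-- `(i k / (2πa)) (r_j / r) K₁(-i k r)`, where `r_j = x_j - ξ_j` and `r = |x - ξ|`. -/
def profileDeriv (ρ ω a : ℝ) (ξ x : Plane) (j : Fin 2) : ℂ :=
  Complex.I * (waveNumber ρ ω a : ℂ) / (2 * (Real.pi : ℂ) * (a : ℂ))
    * (((x j - ξ j) / dist x ξ : ℝ) : ℂ)
    * besselK1 (-Complex.I * (waveNumber ρ ω a : ℂ) * (dist x ξ : ℂ))

/-- The matrix `h = (hᵘ₃₁ hᵘ₃₂; hʷ₃₁ hʷ₃₂)`. -/
def hMatrix (ρ ω ψ a1 a2 : ℝ) (ξ x : Plane) : Matrix (Fin 2) (Fin 2) ℂ :=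
  modalMatrix ψ (profileK ρ ω a1 (dist x ξ)) (profileK ρ ω a2 (dist x ξ))

/-- `v* = Q h = (u*₃₁ u*₃₂; w*₃₁ w*₃₂)`. -/
def vStar (ρ ω ψ a1 a2 : ℝ) (ξ x : Plane) : Matrix (Fin 2) (Fin 2) ℂ :=
  rotationC ψ * hMatrix ρ ω ψ a1 a2 ξ x

/-- The explicit matrix of the derivatives `h_{,j}` in terms of `K₁`. -/
def hDeriv (ρ ω ψ a1 a2 : ℝ) (ξ x : Plane) (j : Fin 2) : Matrix (Fin 2) (Fin 2) ℂ :=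
  modalMatrix ψ (profileDeriv ρ ω a1 ξ x j) (profileDeriv ρ ω a2 ξ x j)

/-! ### Derivatives, stresses and tractions -/

/-- The partial derivative `f_{,j}` with respect to `x_j`. -/
def partialDeriv (j : Fin 2) (f : Plane → ℂ) (x : Plane) : ℂ :=
  fderiv ℝ f x (EuclideanSpace.single j 1)

/-- Phonon stress `σ_{3ij} = c₄₄ u_{3i,j} + R₃ w_{3i,j}` of the `i`-th column of `v`. -/
def phononStress (c44 R3 : ℝ) (v : Plane → Matrix (Fin 2) (Fin 2) ℂ) (i j : Fin 2)
    (x : Plane) : ℂ :=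
  (c44 : ℂ) * partialDeriv j (fun y => v y 0 i) x + (R3 : ℂ) * partialDeriv j (fun y => v y 1 i) x

/-- Phason stress `H_{3ij} = R₃ u_{3i,j} + K₂ w_{3i,j}` of the `i`-th column of `v`. -/
def phasonStress (R3 K2 : ℝ) (v : Plane → Matrix (Fin 2) (Fin 2) ℂ) (i j : Fin 2)
    (x : Plane) : ℂ :=
  (R3 : ℂ) * partialDeriv j (fun y => v y 0 i) x + (K2 : ℂ) * partialDeriv j (fun y => v y 1 i) x

/-- Phonon traction `t_{3i} = σ_{3ij} n_j`. -/
def phononTraction (c44 R3 : ℝ) (v : Plane → Matrix (Fin 2) (Fin 2) ℂ) (i : Fin 2)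
    (n x : Plane) : ℂ :=
  ∑ j : Fin 2, phononStress c44 R3 v i j x * (n j : ℂ)

/-- Phason traction `G_{3i} = H_{3ij} n_j`. -/
def phasonTraction (R3 K2 : ℝ) (v : Plane → Matrix (Fin 2) (Fin 2) ℂ) (i : Fin 2)
    (n x : Plane) : ℂ :=
  ∑ j : Fin 2, phasonStress R3 K2 v i j x * (n j : ℂ)

end AntiPlaneQC

end

noncomputable section

namespace AntiPlaneQC

/-! ### The power series in the definitions of the Bessel functions -/

/-! Since `C` is symmetric and `Q(ψ)` has eigenvectors of `C` as columns, the system decouples: `h =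
diag(p₁, p₂) Qᵀ` with `p_m = K₀(-i k_m r) / (2π a_m)`, so the entries of `v*` are `∑ Q_im Q_jm p_m`.
Everything reduces to the scalar statement `a_m Δp_m + ρω² p_m = -δ`, after which `C Q = Q diag(a₁,
a₂)` and `Q Qᵀ = 1` give the matrix equation (`isFundamentalSolution_vStar`).

The Bessel functions are given by series at the origin, whereas the radiation condition concerns
infinity. The bridge is `besselK0_eq_hankelRep`, which is `K₀(-iy) = 2 e^{iy} ∫₀^∞ e^{-t²} (t² -
2iy)^{-1/2} dt` for `y > 0`. Both sides satisfy `(y f')' = -y f`: on the left by termwise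
differentiation (`hasDerivAt_besselK0`, `hasDerivAt_mul_besselK1`), on the right by an integration
by parts in `t` (`hankelIntegral_recurrence`). Both have the same singular part `-(log(-iy/2) + γ)`
at `0`; on the integral side the constant `γ` comes from `Γ'(1) = -γ`. Their difference is therefore
a solution with zero data at the singular point and vanishes by an energy estimate
(`bessel_ode_unique`). The representation yields global bounds, and `f' - i f = O(y^{-3/2})` is the
radiation condition.

For the distributional equation, a radial profile `g` with `(r g')' + κ r g = 0`, `r g' → c`, and
`g`, `g'` bounded by `M (1 + 1/r)` satisfies `(Δ + κ) g = 2πc δ`. One derivative is moved from the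
test function by regularizing `|u|` to `√(|u|² + ε)` (`integral_mul_fderiv`). In polar coordinates
what remains is, on each ray, an exact derivative whose boundary term at `0` is `c φ(0)`
(`integral_ray`), and the circle contributes `2π`. Here `c = -1/(2πa)`. -/

/-- The sum of the power series with coefficients `c`. -/
def powerSum (c : ℕ → ℂ) (w : ℂ) : ℂ := ∑' n : ℕ, c n * w ^ n

/-- The coefficients of the derivative of a power series. -/
def derivCoeff (c : ℕ → ℂ) (n : ℕ) : ℂ := (n + 1) * c (n + 1)

/-- A growth condition on coefficients, which makes the power series entire. -/
def EntireCoeff (c : ℕ → ℂ) : Prop := ∃ M : ℝ, ∀ n, ‖c n‖ ≤ M * 4 ^ n / n.factorial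

lemma EntireCoeff.summable {c : ℕ → ℂ} (hc : EntireCoeff c) (w : ℂ) :
    Summable fun n => c n * w ^ n := by
  obtain ⟨M, hM⟩ := hc
  refine Summable.of_norm_bounded ((Real.summable_pow_div_factorial (4 * ‖w‖)).mul_left M) ?_
  intro n
  rw [norm_mul, norm_pow]
  refine (mul_le_mul_of_nonneg_right (hM n) (by positivity)).trans (le_of_eq ?_)
  rw [mul_pow]; ring

lemma EntireCoeff.hasDerivAt {c : ℕ → ℂ} (hc : EntireCoeff c) (w : ℂ) :
    HasDerivAt (powerSum c) (powerSum (derivCoeff c) w) w := by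
  have hc' := hc
  obtain ⟨M, hM⟩ := hc'
  set R : ℝ := ‖w‖ + 1
  have hR : 1 ≤ R := by simp [R]
  have hM0 : 0 ≤ M := by simpa using (norm_nonneg _).trans (hM 0)
  -- The factor `n ≤ 2 ^ n` turns the growth `4 ^ n` into `8 ^ n`. Since `1 ≤ R`, the exponent `n -
  -- 1`, truncated at `n = 0`, may be raised to `n`.
  have key : ∀ n : ℕ, ∀ y ∈ Metric.ball (0 : ℂ) R,
      ‖c n * (n * y ^ (n - 1))‖ ≤ M * ((8 * R) ^ n / n.factorial) := by
    intro n y hy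
    have hy' : ‖y‖ ≤ R := by simpa using (Metric.mem_ball.mp hy).le
    rw [norm_mul, norm_mul, norm_pow, Complex.norm_natCast]
    have h1 : (n : ℝ) ≤ 2 ^ n := by exact_mod_cast (Nat.lt_two_pow_self).le
    have h2 : ‖y‖ ^ (n - 1) ≤ R ^ n :=
      (pow_le_pow_left₀ (norm_nonneg _) hy' _).trans (pow_le_pow_right₀ hR (Nat.sub_le _ _))
    calc ‖c n‖ * (n * ‖y‖ ^ (n - 1)) ≤ (M * 4 ^ n / n.factorial) * (2 ^ n * R ^ n) := by
          gcongr
          exact hM n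
      _ = M * ((8 * R) ^ n / n.factorial) := by
          rw [mul_pow, show (8 : ℝ) = 4 * 2 by norm_num, mul_pow]; ring
  have hd := hasDerivAt_tsum_of_isPreconnected
    (u := fun n : ℕ => M * ((8 * R) ^ n / n.factorial)) (g := fun n (y : ℂ) => c n * y ^ n)
    (g' := fun n (y : ℂ) => c n * (n * y ^ (n - 1))) (y₀ := 0) (y := w)
    ((Real.summable_pow_div_factorial (8 * R)).mul_left M) Metric.isOpen_ball
    (convex_ball (0 : ℂ) R).isPreconnected
    (fun n y _ => (hasDerivAt_pow n y).const_mul (c n)) key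
    (Metric.mem_ball_self (by linarith)) (hc.summable 0) (by simp [R])
  convert! hd using 1
  have hs : Summable fun n : ℕ => c n * (n * w ^ (n - 1)) :=
    Summable.of_norm_bounded ((Real.summable_pow_div_factorial (8 * R)).mul_left M)
      fun n => key n w (by simp [R])
  rw [hs.tsum_eq_zero_add]
  simp only [powerSum, derivCoeff, CharP.cast_eq_zero, zero_mul, mul_zero, zero_add,
    Nat.add_sub_cancel]
  refine tsum_congr fun n => ?_
  push_cast; ring

lemma EntireCoeff.powerSum_eq_add {c : ℕ → ℂ} (hc : EntireCoeff c) (w : ℂ) :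
    powerSum c w = c 0 + w * powerSum (fun n => c (n + 1)) w := by
  rw [powerSum, (hc.summable w).tsum_eq_zero_add, powerSum, ← tsum_mul_left]
  simp only [pow_zero, mul_one]
  congr 1
  exact tsum_congr fun n => by ring

lemma powerSum_zero (c : ℕ → ℂ) : powerSum c 0 = c 0 := by
  rw [powerSum, tsum_eq_single 0 (fun n hn => by simp [hn])]
  simp

lemma powerSum_add {c d : ℕ → ℂ} (hc : EntireCoeff c) (hd : EntireCoeff d) (w : ℂ) :
    powerSum (fun n => c n + d n) w = powerSum c w + powerSum d w := by
  rw [powerSum, powerSum, powerSum, ← (hc.summable w).tsum_add (hd.summable w)]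
  exact tsum_congr fun n => by ring

lemma EntireCoeff.continuous {c : ℕ → ℂ} (hc : EntireCoeff c) : Continuous (powerSum c) :=
  continuous_iff_continuousAt.mpr fun w => (hc.hasDerivAt w).continuousAt

lemma EntireCoeff.shift {c : ℕ → ℂ} (hc : EntireCoeff c) : EntireCoeff fun n => c (n + 1) := by
  obtain ⟨M, hM⟩ := hc
  have hM0 : 0 ≤ M := by simpa using (norm_nonneg _).trans (hM 0)
  refine ⟨M * 4, fun n => (hM (n + 1)).trans ?_⟩
  have : (n.factorial : ℝ) ≤ (n + 1).factorial := by
    exact_mod_cast Nat.factorial_le n.le_succ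
  have h0 : (0 : ℝ) < n.factorial := by exact_mod_cast n.factorial_pos
  rw [show M * 4 * 4 ^ n = M * 4 ^ (n + 1) by ring]
  gcongr

lemma EntireCoeff.of_norm_le {c : ℕ → ℂ} (hc : ∀ n, ‖c n‖ * n.factorial ≤ 4 ^ n) :
    EntireCoeff c :=
  ⟨1, fun n => by
    rw [one_mul, le_div_iff₀ (by exact_mod_cast n.factorial_pos)]
    exact hc n⟩

/-- One of the two factorials is enough for the required decay; the other is discarded. -/
lemma entireCoeff_of_mul_sq {c : ℕ → ℂ} {a : ℕ → ℂ} (ha : ∀ n, ‖a n‖ ≤ 4 ^ n)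
    (h : ∀ n, c n * (n.factorial : ℂ) ^ 2 = a n) : EntireCoeff c := by
  refine .of_norm_le fun n => ?_
  have h1 : (1 : ℝ) ≤ n.factorial := by exact_mod_cast n.factorial_pos
  have h2 : ‖c n‖ * (n.factorial : ℝ) ^ 2 = ‖a n‖ := by
    rw [← h n, norm_mul, norm_pow, Complex.norm_natCast]
  calc ‖c n‖ * n.factorial ≤ ‖c n‖ * (n.factorial : ℝ) ^ 2 := by
        gcongr; nlinarith
    _ ≤ 4 ^ n := h2 ▸ ha n

lemma harmonic_le_nat (n : ℕ) : harmonic n ≤ n := by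
  induction n with
  | zero => simp
  | succ n ih =>
    rw [harmonic_succ]
    push_cast
    have : ((n : ℚ) + 1)⁻¹ ≤ 1 := inv_le_one_of_one_le₀ (by linarith [n.cast_nonneg (α := ℚ)])
    linarith

lemma harmonic_nonneg (n : ℕ) : 0 ≤ harmonic n :=
  Finset.sum_nonneg fun i _ => by positivity

lemma norm_harmonic_le (n : ℕ) : ‖((harmonic n : ℚ) : ℂ)‖ ≤ n := by
  rw [← Complex.ofReal_ratCast, Complex.norm_real, Real.norm_of_nonneg
    (by exact_mod_cast harmonic_nonneg n)]
  exact_mod_cast harmonic_le_nat n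

lemma nat_le_two_pow (n : ℕ) : (n : ℝ) ≤ 2 ^ n := by
  exact_mod_cast (Nat.lt_two_pow_self).le

lemma nat_le_four_pow (n : ℕ) : (n : ℝ) ≤ 4 ^ n :=
  (nat_le_two_pow n).trans (pow_le_pow_left₀ (by norm_num) (by norm_num) n)

/-- The coefficients `1 / (n!)²`. -/
def coeffI (n : ℕ) : ℂ := 1 / (n.factorial : ℂ) ^ 2

/-- The coefficients `Hₙ / (n!)²`. -/
def coeffK (n : ℕ) : ℂ := ((harmonic n : ℚ) : ℂ) / (n.factorial : ℂ) ^ 2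

lemma factorial_ne_zeroC (n : ℕ) : (n.factorial : ℂ) ≠ 0 := by exact_mod_cast n.factorial_ne_zero

lemma entireCoeff_coeffI : EntireCoeff coeffI :=
  entireCoeff_of_mul_sq (a := fun _ => 1) (fun n => by
    simpa using one_le_pow₀ (by norm_num : (1 : ℝ) ≤ 4)) fun n => by
    have := factorial_ne_zeroC n
    rw [coeffI]; field_simp

lemma entireCoeff_coeffK : EntireCoeff coeffK :=
  entireCoeff_of_mul_sq (fun n => (norm_harmonic_le n).trans (nat_le_four_pow n)) fun n => by
    have := factorial_ne_zeroC n
    rw [coeffK]; field_simp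

lemma entireCoeff_nat_mul_coeffI : EntireCoeff fun n => n * coeffI n :=
  entireCoeff_of_mul_sq (a := fun n => n) (fun n => by
    simpa using nat_le_four_pow n) fun n => by
    have := factorial_ne_zeroC n
    rw [coeffI]; field_simp

lemma entireCoeff_nat_mul_coeffK : EntireCoeff fun n => n * coeffK n :=
  entireCoeff_of_mul_sq (a := fun n => n * ((harmonic n : ℚ) : ℂ)) (fun n => by
    rw [norm_mul, Complex.norm_natCast]
    calc (n : ℝ) * ‖((harmonic n : ℚ) : ℂ)‖ ≤ 2 ^ n * 2 ^ n := by
          gcongr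
          · exact nat_le_two_pow n
          · exact (norm_harmonic_le n).trans (nat_le_two_pow n)
      _ = 4 ^ n := by rw [← mul_pow]; norm_num) fun n => by
    have := factorial_ne_zeroC n
    rw [coeffK]; field_simp

/-- The derived coefficients are the shift of `n * c n`, so growth is assumed for that sequence.
This is why `4 ^ n` was chosen as the growth rate: it still dominates `n * Hₙ`. -/
lemma EntireCoeff.derivCoeff {c : ℕ → ℂ} (hc : EntireCoeff fun n => n * c n) :
    EntireCoeff (derivCoeff c) := by
  obtain ⟨M, hM⟩ := hc
  have hM0 : 0 ≤ M := by simpa using (norm_nonneg _).trans (hM 0)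
  refine ⟨M * 4, fun n => ?_⟩
  have := hM (n + 1)
  push_cast at this
  refine this.trans ?_
  have : (n.factorial : ℝ) ≤ (n + 1).factorial := by
    exact_mod_cast Nat.factorial_le n.le_succ
  have h0 : (0 : ℝ) < n.factorial := by exact_mod_cast n.factorial_pos
  rw [show M * 4 * 4 ^ n = M * 4 ^ (n + 1) by ring]
  gcongr

lemma mul_powerSum_derivCoeff {c : ℕ → ℂ} (hc : EntireCoeff fun n => n * c n) (w : ℂ) :
    w * powerSum (derivCoeff c) w = powerSum (fun n => n * c n) w := by
  rw [hc.powerSum_eq_add]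
  simp only [CharP.cast_eq_zero, zero_mul, zero_add]
  congr 2
  funext n
  simp [derivCoeff]

lemma factorial_succ_cast (n : ℕ) : ((n + 1).factorial : ℂ) = (n + 1) * n.factorial := by
  rw [Nat.factorial_succ]; push_cast; ring

/-- This is the equation of `I₀` in the variable `w = z² / 4`: the operator `(w f')'` multiplies the
coefficients by `n²` and shifts them, which removes one step of `(n!)²`. -/
lemma hasDerivAt_mul_powerSum_coeffI (w : ℂ) :
    HasDerivAt (fun w => w * powerSum (derivCoeff coeffI) w) (powerSum coeffI w) w := by
  simp only [mul_powerSum_derivCoeff entireCoeff_nat_mul_coeffI]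
  convert! entireCoeff_nat_mul_coeffI.hasDerivAt w using 1
  congr 1
  funext n
  have h1 := factorial_ne_zeroC n
  have h2 : (n : ℂ) + 1 ≠ 0 := Nat.cast_add_one_ne_zero n
  simp only [derivCoeff, coeffI, factorial_succ_cast]
  push_cast
  field_simp

/-- The same shift applies, but `Hₙ₊₁ = Hₙ + 1 / (n + 1)` leaves an extra term, the derivative of
the `I₀` series. It later cancels the terms produced by differentiating the logarithm. -/
lemma hasDerivAt_mul_powerSum_coeffK (w : ℂ) :
    HasDerivAt (fun w => w * powerSum (derivCoeff coeffK) w)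
      (powerSum coeffK w + powerSum (derivCoeff coeffI) w) w := by
  rw [← powerSum_add entireCoeff_coeffK entireCoeff_nat_mul_coeffI.derivCoeff]
  simp only [mul_powerSum_derivCoeff entireCoeff_nat_mul_coeffK]
  convert! entireCoeff_nat_mul_coeffK.hasDerivAt w using 1
  congr 1
  funext n
  have h1 := factorial_ne_zeroC n
  have h2 : (n : ℂ) + 1 ≠ 0 := Nat.cast_add_one_ne_zero n
  simp only [derivCoeff, coeffI, coeffK, factorial_succ_cast, harmonic_succ]
  push_cast
  field_simp

/-! ### Differential equations for `K₀` and `K₁` -/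

lemma besselI0_eq (z : ℂ) : besselI0 z = powerSum coeffI (z ^ 2 / 4) :=
  tsum_congr fun n => by rw [coeffI]; ring

lemma besselI1_eq (z : ℂ) : besselI1 z = z / 2 * powerSum (derivCoeff coeffI) (z ^ 2 / 4) := by
  rw [besselI1, powerSum]
  congr 1
  refine tsum_congr fun n => ?_
  have h1 := factorial_ne_zeroC n
  have h2 : (n : ℂ) + 1 ≠ 0 := Nat.cast_add_one_ne_zero n
  simp only [derivCoeff, coeffI, factorial_succ_cast]
  field_simp

/-- `log (z / 2) + γ`. -/
def shiftedLog (z : ℂ) : ℂ := Complex.log (z / 2) + (Real.eulerMascheroniConstant : ℂ)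

lemma besselK0_eq (z : ℂ) :
    besselK0 z = -shiftedLog z * powerSum coeffI (z ^ 2 / 4) + powerSum coeffK (z ^ 2 / 4) := by
  rw [besselK0, besselI0_eq, shiftedLog]
  congr 1
  exact tsum_congr fun n => by rw [coeffK]; ring

/-- Writing `Hₙ + Hₙ₊₁ = 2 Hₙ₊₁ - 1 / (n + 1)` expresses the series of `K₁` through the two series
of `K₀` and their derivatives. The right side is `-z K₀'(z)` in the variable `w`; the factor `z`
removes the pole. -/
lemma mul_besselK1_eq {z : ℂ} (hz : z ≠ 0) :
    z * besselK1 z = powerSum coeffI (z ^ 2 / 4)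
      + 2 * shiftedLog z * (z ^ 2 / 4 * powerSum (derivCoeff coeffI) (z ^ 2 / 4))
      - 2 * (z ^ 2 / 4 * powerSum (derivCoeff coeffK) (z ^ 2 / 4)) := by
  set w := z ^ 2 / 4 with hw
  have hI := entireCoeff_nat_mul_coeffI.derivCoeff
  have hK := entireCoeff_nat_mul_coeffK.derivCoeff
  have hI1 := entireCoeff_coeffI.shift
  have hsum : (∑' n : ℕ, (((harmonic n : ℚ) : ℂ) + ((harmonic (n + 1) : ℚ) : ℂ)
            - 2 * (Real.eulerMascheroniConstant : ℂ))
          * w ^ n / ((n.factorial : ℂ) * ((n + 1).factorial : ℂ)))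
      = 2 * powerSum (derivCoeff coeffK) w + (-1) * powerSum (fun n => coeffI (n + 1)) w
        + (-2 * (Real.eulerMascheroniConstant : ℂ)) * powerSum (derivCoeff coeffI) w := by
    simp only [powerSum, ← tsum_mul_left]
    rw [← ((hK.summable w).mul_left 2).tsum_add ((hI1.summable w).mul_left (-1)),
      ← (((hK.summable w).mul_left 2).add ((hI1.summable w).mul_left (-1))).tsum_add
        ((hI.summable w).mul_left _)]
    refine tsum_congr fun n => ?_
    have h1 := factorial_ne_zeroC n
    have h2 : (n : ℂ) + 1 ≠ 0 := Nat.cast_add_one_ne_zero n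
    simp only [derivCoeff, coeffI, coeffK, factorial_succ_cast, harmonic_succ]
    push_cast
    field_simp
    ring
  have h3 := entireCoeff_coeffI.powerSum_eq_add w
  rw [show coeffI 0 = 1 by simp [coeffI]] at h3
  rw [besselK1, hsum, besselI1_eq, shiftedLog, h3]
  have h4 : w ≠ 0 := by simp [hw, hz]
  have h5 : z ^ 2 = 4 * w := by rw [hw]; ring
  rw [← hw]
  field_simp
  linear_combination (powerSum (fun n => coeffI (n + 1)) w / 4
    + 1 / 2 * Complex.log (z / 2) * powerSum (derivCoeff coeffI) w
    - 1 / 2 * powerSum (derivCoeff coeffK) w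
    + 1 / 2 * (Real.eulerMascheroniConstant : ℂ) * powerSum (derivCoeff coeffI) w) * h5

lemma hasDerivAt_shiftedLog {z : ℂ} (hz : z ∈ Complex.slitPlane) :
    HasDerivAt shiftedLog (1 / z) z := by
  have hz0 := Complex.slitPlane_ne_zero hz
  have h2 : z / 2 ∈ Complex.slitPlane := by
    rw [Complex.mem_slitPlane_iff] at hz ⊢
    rcases hz with h | h
    · left
      simpa using h
    · right
      simpa using h
  have := (((hasDerivAt_id z).div_const 2).clog h2).add_const (Real.eulerMascheroniConstant : ℂ)
  convert! this using 1
  simp only [id]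
  field_simp

lemma hasDerivAt_sq_div_four (z : ℂ) : HasDerivAt (fun z : ℂ => z ^ 2 / 4) (z / 2) z := by
  convert! ((hasDerivAt_pow 2 z).div_const 4) using 1
  push_cast; ring

lemma hasDerivAt_besselK0 {z : ℂ} (hz : z ∈ Complex.slitPlane) :
    HasDerivAt besselK0 (-besselK1 z) z := by
  have hz0 := Complex.slitPlane_ne_zero hz
  have hw := hasDerivAt_sq_div_four z
  have hA := (entireCoeff_coeffI.hasDerivAt (z ^ 2 / 4)).comp z hw
  have hB := (entireCoeff_coeffK.hasDerivAt (z ^ 2 / 4)).comp z hw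
  have := ((hasDerivAt_shiftedLog hz).neg.mul hA).add hB
  rw [show besselK0 = _ from funext besselK0_eq]
  convert! this using 1
  apply mul_left_cancel₀ hz0
  rw [mul_neg, mul_besselK1_eq hz0]
  simp only [Function.comp, Pi.neg_apply]
  field_simp
  ring

/-- Together with `hasDerivAt_besselK0` this is the modified Bessel equation as a first-order
system. With `A` the `I₀` series, the contributions `z A' / 2`, `z A' / 2` and `-z A'` cancel. -/
lemma hasDerivAt_mul_besselK1 {z : ℂ} (hz : z ∈ Complex.slitPlane) :
    HasDerivAt (fun z => z * besselK1 z) (-(z * besselK0 z)) z := by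
  have hz0 := Complex.slitPlane_ne_zero hz
  have hw := hasDerivAt_sq_div_four z
  have hA := (entireCoeff_coeffI.hasDerivAt (z ^ 2 / 4)).comp z hw
  have hA2 := (hasDerivAt_mul_powerSum_coeffI (z ^ 2 / 4)).comp z hw
  have hB2 := (hasDerivAt_mul_powerSum_coeffK (z ^ 2 / 4)).comp z hw
  have := (hA.add (((hasDerivAt_shiftedLog hz).const_mul 2).mul hA2)).sub (hB2.const_mul 2)
  have heq : (fun z => z * besselK1 z) =ᶠ[𝓝 z] _ :=
    (eventually_ne_nhds hz0).mono fun y hy => mul_besselK1_eq hy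
  refine HasDerivAt.congr_of_eventuallyEq ?_ heq
  convert! this using 1
  rw [besselK0_eq]
  simp only [Function.comp]
  field_simp
  ring

/-! ### Relation to the Hankel function -/

lemma log_neg_I_mul {x : ℝ} (hx : 0 < x) :
    Complex.log (-Complex.I * x) = Complex.log x - Complex.I * (Real.pi / 2) := by
  rw [mul_comm, Complex.log_ofReal_mul hx (by simp), Complex.log_neg_I, Complex.ofReal_log hx.le]
  ring

/-- Because `(-ix)² = -x²`, the series of `I₀` becomes that of `J₀`. The shift `-iπ/2` of the
principal logarithm supplies the `J₀` summand of `H₀⁽¹⁾ = J₀ + i Y₀`. -/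
lemma besselK0_neg_I_mul {x : ℝ} (hx : 0 < x) :
    besselK0 (-Complex.I * x) = Real.pi * Complex.I / 2 * hankelH0 x := by
  have hx2 : 0 < x / 2 := by positivity
  have hlog : Complex.log (-Complex.I * x / 2)
      = Complex.log (x / 2) - Complex.I * (Real.pi / 2) := by
    have := log_neg_I_mul hx2
    push_cast at this
    rw [← this]; congr 1; ring
  have hsq : (-Complex.I * x) ^ 2 / 4 = -((x : ℂ) ^ 2 / 4) := by
    rw [mul_pow, neg_sq, Complex.I_sq]; ring
  have hpi : (Real.pi : ℂ) ≠ 0 := by exact_mod_cast Real.pi_ne_zero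
  rw [besselK0, hankelH0, besselY0, besselI0, besselJ0, hlog, hsq]
  field_simp
  ring_nf
  rw [Complex.I_sq]
  ring

/-! ### An integral representation on the negative imaginary axis -/

/-- `(t² - 2iy)^(-a)`. -/
def hankelKernel (a y t : ℝ) : ℂ := ((t : ℂ) ^ 2 - 2 * Complex.I * y) ^ ((-a : ℝ) : ℂ)

lemma hankelBase_im (y t : ℝ) : ((t : ℂ) ^ 2 - 2 * Complex.I * y).im = -2 * y := by
  simp [pow_two]

lemma hankelBase_re (y t : ℝ) : ((t : ℂ) ^ 2 - 2 * Complex.I * y).re = t ^ 2 := by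
  simp [pow_two]

/-- The imaginary part `-2y` is nonzero, so the base avoids the branch cut for every real `t`; all
differentiations of the kernel rest on this. -/
lemma hankelBase_mem_slitPlane {y : ℝ} (hy : 0 < y) (t : ℝ) :
    (t : ℂ) ^ 2 - 2 * Complex.I * y ∈ Complex.slitPlane := by
  right
  rw [hankelBase_im]
  linarith

lemma hankelBase_ne_zero {y : ℝ} (hy : 0 < y) (t : ℝ) :
    (t : ℂ) ^ 2 - 2 * Complex.I * y ≠ 0 :=
  Complex.slitPlane_ne_zero (hankelBase_mem_slitPlane hy t)

lemma le_norm_hankelBase {y : ℝ} (hy : 0 < y) (t : ℝ) :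
    2 * y ≤ ‖(t : ℂ) ^ 2 - 2 * Complex.I * y‖ := by
  have := Complex.abs_im_le_norm ((t : ℂ) ^ 2 - 2 * Complex.I * y)
  rw [hankelBase_im, abs_mul, abs_of_pos hy] at this
  simpa using this

lemma sq_le_norm_hankelBase (y t : ℝ) : t ^ 2 ≤ ‖(t : ℂ) ^ 2 - 2 * Complex.I * y‖ := by
  have := Complex.re_le_norm ((t : ℂ) ^ 2 - 2 * Complex.I * y)
  rwa [hankelBase_re] at this

lemma norm_hankelBase_le {y : ℝ} (hy : 0 < y) (t : ℝ) :
    ‖(t : ℂ) ^ 2 - 2 * Complex.I * y‖ ≤ t ^ 2 + 2 * y := by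
  refine (norm_sub_le _ _).trans (le_of_eq ?_)
  simp [abs_of_pos hy]

lemma norm_hankelKernel (a y t : ℝ) :
    ‖hankelKernel a y t‖ = ‖(t : ℂ) ^ 2 - 2 * Complex.I * y‖ ^ (-a) :=
  Complex.norm_cpow_real _ _

lemma norm_hankelKernel_le {a y : ℝ} (ha : 0 ≤ a) (hy : 0 < y) (t : ℝ) :
    ‖hankelKernel a y t‖ ≤ (2 * y) ^ (-a) := by
  rw [norm_hankelKernel]
  exact Real.rpow_le_rpow_of_nonpos (by positivity) (le_norm_hankelBase hy t) (by linarith)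

lemma hankelKernel_mul {y : ℝ} (hy : 0 < y) (a b t : ℝ) :
    hankelKernel a y t * hankelKernel b y t = hankelKernel (a + b) y t := by
  rw [hankelKernel, hankelKernel, hankelKernel, ← Complex.cpow_add _ _ (hankelBase_ne_zero hy t)]
  congr 1
  push_cast; ring

lemma base_mul_hankelKernel {y : ℝ} (hy : 0 < y) (a t : ℝ) :
    ((t : ℂ) ^ 2 - 2 * Complex.I * y) * hankelKernel (a + 1) y t = hankelKernel a y t := by
  have : (t : ℂ) ^ 2 - 2 * Complex.I * y = hankelKernel (-1) y t := by simp [hankelKernel]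
  rw [this, hankelKernel_mul hy]
  congr 1; ring

lemma hasDerivAt_hankelKernel_left {y : ℝ} (hy : 0 < y) (a t : ℝ) :
    HasDerivAt (fun y => hankelKernel a y t) (2 * Complex.I * a * hankelKernel (a + 1) y t) y := by
  have h1 : HasDerivAt (fun y : ℝ => (t : ℂ) ^ 2 - 2 * Complex.I * y) (-(2 * Complex.I)) y := by
    simpa using ((hasDerivAt_id y).ofReal_comp.const_mul (2 * Complex.I)).const_sub ((t : ℂ) ^ 2)
  have h2 := ((Complex.hasStrictDerivAt_cpow_const (c := ((-a : ℝ) : ℂ))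
    (hankelBase_mem_slitPlane hy t)).hasDerivAt).comp y h1
  convert! h2 using 1
  rw [hankelKernel, show ((-(a + 1) : ℝ) : ℂ) = ((-a : ℝ) : ℂ) - 1 by push_cast; ring]
  push_cast
  ring

lemma hasDerivAt_hankelKernel_right {y : ℝ} (hy : 0 < y) (a t : ℝ) :
    HasDerivAt (fun t => hankelKernel a y t) (-2 * a * t * hankelKernel (a + 1) y t) t := by
  have h1 : HasDerivAt (fun t : ℝ => (t : ℂ) ^ 2 - 2 * Complex.I * y)
      (2 * (t : ℂ)) t := by
    simpa using ((hasDerivAt_id t).ofReal_comp.pow 2).sub_const (2 * Complex.I * (y : ℂ))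
  have h2 := HasDerivAt.comp (h := fun t : ℝ => (t : ℂ) ^ 2 - 2 * Complex.I * y) t
    ((Complex.hasStrictDerivAt_cpow_const (c := ((-a : ℝ) : ℂ))
      (hankelBase_mem_slitPlane hy t)).hasDerivAt) h1
  convert! h2 using 1
  rw [hankelKernel, show ((-(a + 1) : ℝ) : ℂ) = ((-a : ℝ) : ℂ) - 1 by push_cast; ring]
  push_cast
  ring

lemma continuous_hankelKernel {y : ℝ} (hy : 0 < y) (a : ℝ) : Continuous (hankelKernel a y) :=
  continuous_iff_continuousAt.mpr fun t => (hasDerivAt_hankelKernel_right hy a t).continuousAt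

/-- The Gaussian `exp (-t²)` as a complex number. -/
def gaussC (t : ℝ) : ℂ := (Real.exp (-t ^ 2) : ℂ)

lemma hasDerivAt_gaussC (t : ℝ) : HasDerivAt gaussC (-2 * t * gaussC t) t := by
  have h := (((hasDerivAt_pow 2 t).neg).exp).ofReal_comp
  convert! h using 1
  simp only [gaussC, Pi.neg_apply]
  push_cast
  ring

lemma continuous_gaussC : Continuous gaussC :=
  continuous_iff_continuousAt.mpr fun t => (hasDerivAt_gaussC t).continuousAt

lemma norm_gaussC (t : ℝ) : ‖gaussC t‖ = Real.exp (-t ^ 2) := by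
  rw [gaussC, Complex.norm_real, Real.norm_of_nonneg (Real.exp_pos _).le]

lemma integrable_pow_mul_exp_neg_sq (n : ℕ) :
    Integrable fun t : ℝ => t ^ n * Real.exp (-t ^ 2) := by
  have := integrable_rpow_mul_exp_neg_mul_sq (b := 1) one_pos (s := n)
    (by linarith [n.cast_nonneg (α := ℝ)])
  simpa using this

lemma tendsto_pow_mul_exp_neg_sq (n : ℕ) :
    Tendsto (fun t : ℝ => t ^ n * Real.exp (-t ^ 2)) atTop (𝓝 0) := by
  have h := (Real.tendsto_pow_mul_exp_neg_atTop_nhds_zero n)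
  refine squeeze_zero' ((eventually_ge_atTop 0).mono fun t ht => by positivity)
    ((eventually_ge_atTop 1).mono fun t ht => ?_) h
  gcongr
  nlinarith

lemma integrable_gaussC_mul {f : ℝ → ℂ} {M : ℝ} (n : ℕ) {s : Set ℝ} (hs : MeasurableSet s)
    (hf : ContinuousOn f s) (hM : ∀ t ∈ s, ‖f t‖ ≤ M * |t| ^ n) :
    IntegrableOn (fun t => gaussC t * f t) s := by
  refine Integrable.mono' (g := fun t => M * ‖t ^ n * Real.exp (-t ^ 2)‖)
    (((integrable_pow_mul_exp_neg_sq n).norm.const_mul M).integrableOn)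
    ((continuous_gaussC.continuousOn.mul hf).aestronglyMeasurable hs)
    ((ae_restrict_iff' hs).mpr (Eventually.of_forall fun t ht => ?_))
  rw [norm_mul, norm_gaussC, norm_mul, norm_pow, Real.norm_eq_abs,
    Real.norm_of_nonneg (Real.exp_pos _).le]
  nlinarith [hM t ht, Real.exp_pos (-t ^ 2)]

lemma integrable_gaussC_mul_hankelKernel {a y : ℝ} (ha : 0 ≤ a) (hy : 0 < y) :
    IntegrableOn (fun t => gaussC t * hankelKernel a y t) (Set.Ioi 0) :=
  integrable_gaussC_mul (M := (2 * y) ^ (-a)) 0 measurableSet_Ioi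
    (continuous_hankelKernel hy a).continuousOn fun t _ => by
      simpa using norm_hankelKernel_le ha hy t

/-- `2 ∫₀^∞ exp (-t²) (t² - 2iy)^(-a) dt`. -/
def hankelIntegral (a y : ℝ) : ℂ := 2 * ∫ t in Set.Ioi (0 : ℝ), gaussC t * hankelKernel a y t

lemma integral_exp_neg_sq_Ioi_le : ∫ t in Set.Ioi (0 : ℝ), Real.exp (-t ^ 2) ≤ 1 := by
  have h := integral_gaussian_Ioi 1
  simp only [neg_mul, one_mul, div_one] at h
  rw [h]
  have : √Real.pi ≤ 2 := by
    rw [Real.sqrt_le_left (by norm_num)]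
    linarith [Real.pi_le_four]
  linarith

lemma norm_integral_gaussC_mul_le {f : ℝ → ℂ} {M : ℝ} (hM : ∀ t, 0 < t → ‖f t‖ ≤ M) :
    ‖∫ t in Set.Ioi (0 : ℝ), gaussC t * f t‖ ≤ M := by
  have hM0 : 0 ≤ M := (norm_nonneg _).trans (hM 1 one_pos)
  calc _ ≤ ∫ t in Set.Ioi (0 : ℝ), M * Real.exp (-t ^ 2) := by
        refine norm_integral_le_of_norm_le ?_ ?_
        · have := (integrable_pow_mul_exp_neg_sq 0).const_mul M
          simp only [pow_zero, one_mul] at this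
          exact this.integrableOn
        · refine (ae_restrict_iff' measurableSet_Ioi).mpr (Eventually.of_forall fun t ht => ?_)
          rw [norm_mul, norm_gaussC, mul_comm]
          exact mul_le_mul_of_nonneg_right (hM t ht) (Real.exp_pos _).le
    _ ≤ M := by
        rw [integral_const_mul]
        nlinarith [integral_exp_neg_sq_Ioi_le]

lemma norm_hankelIntegral_le {a y : ℝ} (ha : 0 ≤ a) (hy : 0 < y) :
    ‖hankelIntegral a y‖ ≤ 2 * (2 * y) ^ (-a) := by
  rw [hankelIntegral, norm_mul, Complex.norm_ofNat]
  gcongr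
  exact norm_integral_gaussC_mul_le fun t _ => norm_hankelKernel_le ha hy t

lemma hasDerivAt_hankelIntegral {a y : ℝ} (ha : 0 ≤ a) (hy : 0 < y) :
    HasDerivAt (hankelIntegral a) (2 * Complex.I * a * hankelIntegral (a + 1) y) y := by
  -- For `x > y / 2` the kernel bound `(2x) ^ (-(a + 1))` is at most `y ^ (-(a + 1))`, which makes
  -- the dominating function independent of `x`.
  have hs : Set.Ioi (y / 2) ∈ 𝓝 y := Ioi_mem_nhds (by linarith)
  have hpos : ∀ x ∈ Set.Ioi (y / 2), 0 < x := fun x hx => (by positivity : 0 < y / 2).trans hx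
  have h := hasDerivAt_integral_of_dominated_loc_of_deriv_le
    (μ := volume.restrict (Set.Ioi (0 : ℝ)))
    (F := fun y t => gaussC t * hankelKernel a y t)
    (F' := fun y t => gaussC t * (2 * Complex.I * a * hankelKernel (a + 1) y t))
    (bound := fun t => Real.exp (-t ^ 2) * (2 * a * y ^ (-(a + 1)))) hs
    (by
      filter_upwards [hs] with x hx
      exact (continuous_gaussC.mul (continuous_hankelKernel (hpos x hx) a)).aestronglyMeasurable)
    (integrable_gaussC_mul_hankelKernel ha hy)
    (continuous_gaussC.mul
      (continuous_const.mul (continuous_hankelKernel hy (a + 1)))).aestronglyMeasurable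
    (Eventually.of_forall fun t x hx => by
      rw [norm_mul, norm_gaussC, norm_mul]
      have h1 : ‖2 * Complex.I * (a : ℂ)‖ = 2 * a := by
        simp [abs_of_nonneg ha]
      rw [h1]
      gcongr
      refine (norm_hankelKernel_le (by linarith) (hpos x hx) t).trans ?_
      refine Real.rpow_le_rpow_of_nonpos hy ?_ (by linarith)
      have := Set.mem_Ioi.mp hx
      linarith)
    (by
      have := (integrable_pow_mul_exp_neg_sq 0).mul_const (2 * a * y ^ (-(a + 1)))
      simp only [pow_zero, one_mul] at this
      exact this.integrableOn)
    (Eventually.of_forall fun t x hx =>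
      (hasDerivAt_hankelKernel_left (hpos x hx) a t).const_mul (gaussC t))
  convert! h.2.const_mul 2 using 1
  rw [hankelIntegral, ← integral_const_mul, ← integral_const_mul, ← integral_const_mul]
  congr 1
  funext t
  ring

lemma tendsto_gaussC_mul {f : ℝ → ℂ} {M : ℝ} (n : ℕ) (hM : ∀ t, 1 ≤ t → ‖f t‖ ≤ M * t ^ n) :
    Tendsto (fun t => gaussC t * f t) atTop (𝓝 0) := by
  have h := (tendsto_pow_mul_exp_neg_sq n).const_mul M
  rw [mul_zero] at h
  refine squeeze_zero_norm' ((eventually_ge_atTop 1).mono fun t ht => ?_) h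
  rw [norm_mul, norm_gaussC]
  nlinarith [hM t ht, Real.exp_pos (-t ^ 2)]

/-- The derivative of `e^{-t²} t (t² - 2iy)^{-3/2}` integrates to zero: the factor `t` kills the
boundary term at `0` and the Gaussian the one at infinity. Each `t²` is rewritten as base plus
`2iy`. The relation is Bessel's equation for the representation in disguise. -/
lemma hankelIntegral_recurrence {y : ℝ} (hy : 0 < y) :
    hankelIntegral (1 / 2) y + (1 + 2 * Complex.I * y) * hankelIntegral (3 / 2) y
      + 3 * Complex.I * y * hankelIntegral (5 / 2) y = 0 := by
  have hd : ∀ t : ℝ, HasDerivAt (fun t : ℝ => gaussC t * (t * hankelKernel (3 / 2) y t))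
      (-2 * (gaussC t * hankelKernel (1 / 2) y t)
        + (-2 * (1 + 2 * Complex.I * y)) * (gaussC t * hankelKernel (3 / 2) y t)
        + (-2 * (3 * Complex.I * y)) * (gaussC t * hankelKernel (5 / 2) y t)) t := by
    intro t
    have h := (hasDerivAt_gaussC t).mul
      ((hasDerivAt_id t).ofReal_comp.mul (hasDerivAt_hankelKernel_right hy (3 / 2) t))
    convert! h using 1
    have h1 := base_mul_hankelKernel hy (1 / 2) t
    have h2 := base_mul_hankelKernel hy (3 / 2) t
    norm_num at h1 h2 ⊢
    rw [← h1, ← h2]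
    ring
  have hi := fun (a : ℝ) (ha : 0 ≤ a) => integrable_gaussC_mul_hankelKernel ha hy
  have h := integral_Ioi_of_hasDerivAt_of_tendsto' (a := 0) (fun t _ => hd t)
    ((((hi (1 / 2) (by norm_num)).const_mul _).add ((hi (3 / 2) (by norm_num)).const_mul _)).add
      ((hi (5 / 2) (by norm_num)).const_mul _))
    (tendsto_gaussC_mul (M := (2 * y) ^ (-(3 / 2) : ℝ)) 1 fun t ht => by
      rw [norm_mul, Complex.norm_real, Real.norm_of_nonneg (by linarith), pow_one, mul_comm]
      exact mul_le_mul_of_nonneg_right (norm_hankelKernel_le (by norm_num) hy t) (by linarith))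
  have h3 := integral_add (((hi (1 / 2) (by norm_num)).const_mul (-2)).add
    ((hi (3 / 2) (by norm_num)).const_mul (-2 * (1 + 2 * Complex.I * y))))
    ((hi (5 / 2) (by norm_num)).const_mul (-2 * (3 * Complex.I * y)))
  simp only [Pi.add_apply] at h3
  rw [h3, integral_add ((hi (1 / 2) (by norm_num)).const_mul _)
      ((hi (3 / 2) (by norm_num)).const_mul _),
    integral_const_mul, integral_const_mul, integral_const_mul] at h
  simp only [Complex.ofReal_zero, zero_mul, mul_zero, sub_zero] at h
  simp only [hankelIntegral]
  linear_combination -h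

/-- Here the base is bounded below by `t²` instead of `2y`, so the bound does not degenerate as `y →
0`; it provides the dominating functions for that limit. -/
lemma norm_mul_hankelKernel_half_le {y t : ℝ} (ht : 0 < t) :
    ‖(t : ℂ) * hankelKernel (1 / 2) y t‖ ≤ 1 := by
  rw [norm_mul, Complex.norm_real, Real.norm_of_nonneg ht.le, norm_hankelKernel]
  calc t * ‖(t : ℂ) ^ 2 - 2 * Complex.I * y‖ ^ (-(1 / 2) : ℝ)
      ≤ t * (t ^ 2) ^ (-(1 / 2) : ℝ) := by
        gcongr ?_ * ?_
        exact Real.rpow_le_rpow_of_nonpos (by positivity) (sq_le_norm_hankelBase y t) (by norm_num)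
    _ = 1 := by
        rw [← Real.rpow_natCast, ← Real.rpow_mul ht.le]
        norm_num
        rw [Real.rpow_neg_one]
        field_simp

lemma integrable_gaussC_mul_sq_hankelKernel {y : ℝ} (hy : 0 < y) :
    IntegrableOn (fun t : ℝ => gaussC t * (t * (t * hankelKernel (1 / 2) y t))) (Set.Ioi 0) :=
  integrable_gaussC_mul (M := 1) 1 measurableSet_Ioi
    (Complex.continuous_ofReal.mul
      (Complex.continuous_ofReal.mul (continuous_hankelKernel hy _))).continuousOn fun t ht => by
      rw [norm_mul, Complex.norm_real, Real.norm_eq_abs, pow_one, one_mul]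
      exact mul_le_of_le_one_right (abs_nonneg t) (norm_mul_hankelKernel_half_le ht)

/-- The derivative of `t (t² - 2iy)^{-1/2}` is `-2iy (t² - 2iy)^{-3/2}`. Integrating by parts
against the Gaussian thus isolates the `1/y` singularity and leaves an integral that converges as `y
→ 0`. -/
lemma mul_hankelIntegral_three_halves {y : ℝ} (hy : 0 < y) :
    y * hankelIntegral (3 / 2) y = 2 * Complex.I *
      ∫ t in Set.Ioi (0 : ℝ), gaussC t * (t * (t * hankelKernel (1 / 2) y t)) := by
  have hd : ∀ t : ℝ, HasDerivAt (fun t : ℝ => gaussC t * (t * hankelKernel (1 / 2) y t))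
      (-2 * (gaussC t * (t * (t * hankelKernel (1 / 2) y t)))
        + (-2 * Complex.I * y) * (gaussC t * hankelKernel (3 / 2) y t)) t := by
    intro t
    have h := (hasDerivAt_gaussC t).mul
      ((hasDerivAt_id t).ofReal_comp.mul (hasDerivAt_hankelKernel_right hy (1 / 2) t))
    convert! h using 1
    have h1 := base_mul_hankelKernel hy (1 / 2) t
    norm_num at h1 ⊢
    rw [← h1]
    ring
  have hi1 := integrable_gaussC_mul_sq_hankelKernel hy
  have hi2 := integrable_gaussC_mul_hankelKernel (a := 3 / 2) (by norm_num) hy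
  have h := integral_Ioi_of_hasDerivAt_of_tendsto' (a := 0) (fun t _ => hd t)
    ((hi1.const_mul _).add (hi2.const_mul _))
    (tendsto_gaussC_mul (M := 1) 0 fun t ht => by
      simpa using norm_mul_hankelKernel_half_le (by linarith))
  rw [integral_add (hi1.const_mul _) (hi2.const_mul _), integral_const_mul,
    integral_const_mul] at h
  simp only [Complex.ofReal_zero, zero_mul, mul_zero, sub_zero] at h
  simp only [hankelIntegral]
  linear_combination Complex.I * h + 2 * y * (∫ t in Set.Ioi (0 : ℝ),
    gaussC t * hankelKernel (3 / 2) y t) * Complex.I_sq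

lemma integral_mul_gaussC_Ioi : ∫ t in Set.Ioi (0 : ℝ), gaussC t * t = 1 / 2 := by
  have hd : ∀ t : ℝ, HasDerivAt (fun t : ℝ => -1 / 2 * gaussC t) (gaussC t * t) t := by
    intro t
    convert! (hasDerivAt_gaussC t).const_mul (-1 / 2) using 1
    ring
  have hl : Tendsto (fun t : ℝ => -1 / 2 * gaussC t) atTop (𝓝 0) := by
    have := (tendsto_gaussC_mul (f := fun _ => 1) (M := 1) 0 (by simp)).const_mul (-1 / 2 : ℂ)
    simpa using this
  rw [integral_Ioi_of_hasDerivAt_of_tendsto' (fun t _ => hd t) ?_ hl]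
  · simp [gaussC]; norm_num
  · exact integrable_gaussC_mul (M := 1) 1 measurableSet_Ioi
      Complex.continuous_ofReal.continuousOn fun t _ => by simp

lemma norm_mul_hankelIntegral_three_halves_le {y : ℝ} (hy : 0 < y) :
    ‖y * hankelIntegral (3 / 2) y‖ ≤ 1 := by
  have h2 : ∫ t in Set.Ioi (0 : ℝ), t * Real.exp (-t ^ 2) = 1 / 2 := by
    have h := integral_mul_gaussC_Ioi
    have : ∀ t : ℝ, gaussC t * t = ((t * Real.exp (-t ^ 2) : ℝ) : ℂ) := by
      intro t; rw [gaussC]; push_cast; ring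
    simp only [this] at h
    rw [integral_complex_ofReal] at h
    apply Complex.ofReal_injective
    rw [h]
    push_cast
    ring
  rw [mul_hankelIntegral_three_halves hy, norm_mul]
  have h1 : ‖∫ t in Set.Ioi (0 : ℝ), gaussC t * (t * (t * hankelKernel (1 / 2) y t))‖
      ≤ ∫ t in Set.Ioi (0 : ℝ), t * Real.exp (-t ^ 2) := by
    refine norm_integral_le_of_norm_le ?_ ?_
    · have := integrable_pow_mul_exp_neg_sq 1
      simp only [pow_one] at this
      exact this.integrableOn
    · refine (ae_restrict_iff' measurableSet_Ioi).mpr (Eventually.of_forall fun t ht => ?_)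
      rw [norm_mul, norm_gaussC, norm_mul, Complex.norm_real, Real.norm_of_nonneg
        (le_of_lt ht), mul_comm]
      exact mul_le_mul_of_nonneg_right (mul_le_of_le_one_right (le_of_lt ht)
        (norm_mul_hankelKernel_half_le ht)) (Real.exp_pos _).le
  rw [h2] at h1
  simp only [norm_mul, Complex.norm_ofNat, Complex.norm_I]
  linarith

/-- Continuity of the kernel up to `y = 0` for `t > 0`. -/
lemma tendsto_hankelKernel (a : ℝ) {t : ℝ} (ht : 0 < t) :
    Tendsto (fun y => hankelKernel a y t) (𝓝[>] 0) (𝓝 ((t ^ (-2 * a) : ℝ) : ℂ)) := by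
  have hmem : (t : ℂ) ^ 2 - 2 * Complex.I * (0 : ℝ) ∈ Complex.slitPlane := by
    left
    rw [hankelBase_re]; positivity
  have hc : ContinuousAt (fun y : ℝ => hankelKernel a y t) 0 := by
    unfold hankelKernel
    refine ContinuousAt.cpow (by fun_prop) continuousAt_const hmem
  have := hc.tendsto.mono_left (nhdsWithin_le_nhds (s := Set.Ioi 0))
  convert this using 2
  rw [hankelKernel]
  simp only [Complex.ofReal_zero, mul_zero, sub_zero]
  rw [← Complex.ofReal_pow, ← Complex.ofReal_cpow (by positivity), ← Real.rpow_natCast,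
    ← Real.rpow_mul ht.le]
  congr 2
  push_cast; ring

/-- In the limit the integrand becomes `t e^{-t²}`, with integral `1/2`, so the prefactor `2i` gives
`i`. -/
lemma tendsto_mul_hankelIntegral_three_halves :
    Tendsto (fun y : ℝ => y * hankelIntegral (3 / 2) y) (𝓝[>] 0) (𝓝 Complex.I) := by
  have h : Tendsto (fun y : ℝ => ∫ t in Set.Ioi (0 : ℝ),
      gaussC t * (t * (t * hankelKernel (1 / 2) y t))) (𝓝[>] 0)
      (𝓝 (∫ t in Set.Ioi (0 : ℝ), gaussC t * t)) := by
    refine tendsto_integral_filter_of_dominated_convergence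
      (fun t => t * Real.exp (-t ^ 2)) ?_ ?_ ?_ ?_
    · filter_upwards [self_mem_nhdsWithin] with y hy
      exact (integrable_gaussC_mul_sq_hankelKernel hy).1
    · filter_upwards [self_mem_nhdsWithin] with y hy
      refine (ae_restrict_iff' measurableSet_Ioi).mpr (Eventually.of_forall fun t ht => ?_)
      rw [norm_mul, norm_gaussC, norm_mul, Complex.norm_real, Real.norm_of_nonneg
        (le_of_lt ht), mul_comm]
      exact mul_le_mul_of_nonneg_right (mul_le_of_le_one_right (le_of_lt ht)
        (norm_mul_hankelKernel_half_le ht)) (Real.exp_pos _).le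
    · have := integrable_pow_mul_exp_neg_sq 1
      simp only [pow_one] at this
      exact this.integrableOn
    · refine (ae_restrict_iff' measurableSet_Ioi).mpr (Eventually.of_forall fun t ht => ?_)
      have ht' : (0 : ℝ) < t := ht
      have := (((tendsto_hankelKernel (1 / 2) ht').const_mul (t : ℂ)).const_mul (t : ℂ)).const_mul
        (gaussC t)
      convert this using 3
      norm_num
      rw [Real.rpow_neg_one, Complex.ofReal_inv]
      have : (t : ℂ) ≠ 0 := by exact_mod_cast ht'.ne'
      field_simp
  rw [integral_mul_gaussC_Ioi] at h
  have h2 := h.const_mul (2 * Complex.I)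
  rw [show 2 * Complex.I * (1 / 2) = Complex.I by ring] at h2
  refine h2.congr' ?_
  filter_upwards [self_mem_nhdsWithin] with y hy
  exact (mul_hankelIntegral_three_halves hy).symm

/-! ### Behaviour of the integral representation at the origin -/

lemma integrable_gaussC_mul_of_le {f : ℝ → ℂ} {M : ℝ} (n : ℕ)
    (hf : ContinuousOn f (Set.Ioi 0)) (hM : ∀ t, 0 < t → ‖f t‖ ≤ M * (1 + t ^ n)) :
    IntegrableOn (fun t => gaussC t * f t) (Set.Ioi 0) := by
  have hg : Integrable
      (fun t : ℝ => M * (t ^ 0 * Real.exp (-t ^ 2) + t ^ n * Real.exp (-t ^ 2))) :=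
    ((integrable_pow_mul_exp_neg_sq 0).add (integrable_pow_mul_exp_neg_sq n)).const_mul M
  refine Integrable.mono' hg.integrableOn
    ((continuous_gaussC.continuousOn.mul hf).aestronglyMeasurable measurableSet_Ioi)
    ((ae_restrict_iff' measurableSet_Ioi).mpr (Eventually.of_forall fun t ht => ?_))
  rw [norm_mul, norm_gaussC]
  nlinarith [hM t ht, Real.exp_pos (-t ^ 2)]

/-- Off the cut the argument lies in `(-π, π)`, so the principal square root has argument in `(-π/2,
π/2)`. This keeps the logarithm in `hankelLog` away from its cut for `t ≥ 0`. -/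
lemma hankelKernel_neg_half_re_pos {y : ℝ} (hy : 0 < y) (t : ℝ) :
    0 < (hankelKernel (-1 / 2) y t).re := by
  have hs := hankelBase_mem_slitPlane hy t
  rw [hankelKernel, Complex.cpow_ofReal_re]
  have h0 : 0 < ‖(t : ℂ) ^ 2 - 2 * Complex.I * y‖ := norm_pos_iff.mpr (hankelBase_ne_zero hy t)
  refine mul_pos (Real.rpow_pos_of_pos h0 _) (Real.cos_pos_of_mem_Ioo ⟨?_, ?_⟩)
  · have := Complex.neg_pi_lt_arg ((t : ℂ) ^ 2 - 2 * Complex.I * y)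
    linarith
  · have := lt_of_le_of_ne (Complex.arg_le_pi ((t : ℂ) ^ 2 - 2 * Complex.I * y))
      (Complex.slitPlane_arg_ne_pi hs)
    linarith

lemma le_re_add_hankelKernel {y : ℝ} (hy : 0 < y) (t : ℝ) :
    t < ((t : ℂ) + hankelKernel (-1 / 2) y t).re := by
  rw [Complex.add_re, Complex.ofReal_re]
  linarith [hankelKernel_neg_half_re_pos hy t]

/-- `log (t + √(t² - 2iy))`. -/
def hankelLog (y t : ℝ) : ℂ := Complex.log (t + hankelKernel (-1 / 2) y t)

/-- With `s = √(t² - 2iy)`, the derivative of `log (t + s)` is `(1 + t/s) / (t + s) = 1/s`. -/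
lemma hasDerivAt_hankelLog {y t : ℝ} (hy : 0 < y) (ht : 0 ≤ t) :
    HasDerivAt (hankelLog y) (hankelKernel (1 / 2) y t) t := by
  have hs : (t : ℂ) + hankelKernel (-1 / 2) y t ∈ Complex.slitPlane :=
    Or.inl (ht.trans_lt (le_re_add_hankelKernel hy t))
  have h0 := Complex.slitPlane_ne_zero hs
  have h := (((hasDerivAt_id t).ofReal_comp).add
    (hasDerivAt_hankelKernel_right hy (-1 / 2) t)).clog_real hs
  convert! h using 1
  have h1 : hankelKernel (-1 / 2) y t * hankelKernel (1 / 2) y t = 1 := by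
    rw [hankelKernel_mul hy]
    norm_num [hankelKernel]
  simp only [Pi.add_apply, id]
  rw [eq_div_iff h0]
  norm_num at h1 ⊢
  linear_combination h1

/-- The factor `t` absorbs the logarithmic singularity at `t = 0`. The constant stays bounded as `y
→ 0`, so the estimate also serves for dominated convergence. -/
lemma norm_mul_hankelLog_le {y t : ℝ} (hy : 0 < y) (ht : 0 < t) :
    ‖(t : ℂ) * hankelLog y t‖ ≤ (2 * y + 8) * (1 + t ^ 3) := by
  set w := (t : ℂ) + hankelKernel (-1 / 2) y t with hw
  have h1 : t ≤ ‖w‖ := (le_re_add_hankelKernel hy t).le.trans (Complex.re_le_norm _)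
  have hw0 : 0 < ‖w‖ := ht.trans_le h1
  have h2 : ‖w‖ ≤ t + (1 + (t ^ 2 + 2 * y)) := by
    refine (norm_add_le _ _).trans ?_
    rw [Complex.norm_real, Real.norm_of_nonneg ht.le, norm_hankelKernel]
    gcongr
    set p := ‖(t : ℂ) ^ 2 - 2 * Complex.I * y‖
    have hp : p ≤ t ^ 2 + 2 * y := norm_hankelBase_le hy t
    have hp0 : 0 ≤ p := norm_nonneg _
    have h3 : p ^ (-(-1 / 2) : ℝ) ≤ (1 + p) ^ (-(-1 / 2) : ℝ) :=
      Real.rpow_le_rpow hp0 (by linarith) (by norm_num)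
    have h4 : (1 + p) ^ (-(-1 / 2) : ℝ) ≤ (1 + p) ^ (1 : ℝ) :=
      Real.rpow_le_rpow_of_exponent_le (by linarith) (by norm_num)
    rw [Real.rpow_one] at h4
    linarith
  -- Below, `log ‖w‖ ≥ log t ≥ 1 - 1/t`; above, `log ‖w‖ ≤ ‖w‖ - 1`.
  have h5 : |Real.log ‖w‖| ≤ t + t ^ 2 + 2 * y + t⁻¹ := by
    have hti : 0 < t⁻¹ := inv_pos.mpr ht
    rw [abs_le]
    constructor
    · have := Real.one_sub_inv_le_log_of_pos ht
      have := Real.log_le_log ht h1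
      nlinarith [sq_nonneg t]
    · have := Real.log_le_sub_one_of_pos hw0
      linarith
  have h6 : ‖hankelLog y t‖ ≤ t + t ^ 2 + 2 * y + t⁻¹ + 4 := by
    refine (Complex.norm_le_abs_re_add_abs_im _).trans ?_
    rw [hankelLog, Complex.log_re, Complex.log_im]
    have := (Complex.abs_arg_le_pi w).trans Real.pi_le_four
    exact add_le_add h5 this
  rw [norm_mul, Complex.norm_real, Real.norm_of_nonneg ht.le]
  have h7 : t * t⁻¹ = 1 := mul_inv_cancel₀ ht.ne'
  have h8 := mul_le_mul_of_nonneg_left h6 ht.le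
  have h9 : t ≤ 1 + t ^ 3 := by
    rcases le_total t 1 with h | h
    · nlinarith [pow_pos ht 3]
    · nlinarith [mul_pos ht ht]
  have h10 : t ^ 2 ≤ 1 + t ^ 3 := by
    rcases le_total t 1 with h | h
    · nlinarith [pow_pos ht 3]
    · nlinarith [mul_pos ht ht]
  have h11 : y * t ≤ y * (1 + t ^ 3) := mul_le_mul_of_nonneg_left h9 hy.le
  have h12 : t * (t + t ^ 2 + 2 * y + t⁻¹ + 4) = t ^ 2 + t ^ 3 + 2 * (y * t) + 1 + 4 * t := by
    rw [← h7]; ring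
  nlinarith [pow_pos ht 3]

lemma continuousOn_hankelLog {y : ℝ} (hy : 0 < y) : ContinuousOn (hankelLog y) (Set.Ioi 0) :=
  fun _ ht => (hasDerivAt_hankelLog hy (le_of_lt ht)).continuousAt.continuousWithinAt

lemma integrable_gaussC_mul_hankelLog {y : ℝ} (hy : 0 < y) :
    IntegrableOn (fun t : ℝ => gaussC t * (t * hankelLog y t)) (Set.Ioi 0) :=
  integrable_gaussC_mul_of_le 3
    (Complex.continuous_ofReal.continuousOn.mul (continuousOn_hankelLog hy))
    fun _ ht => norm_mul_hankelLog_le hy ht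

/-- Integration by parts uses `hankelLog` as antiderivative of the kernel. Its value at `t = 0` is
half of `log (-2iy)` and carries the whole singularity; the remaining integral has a finite limit as
`y → 0`. -/
lemma hankelIntegral_half_eq {y : ℝ} (hy : 0 < y) :
    hankelIntegral (1 / 2) y = -Complex.log (-Complex.I * (2 * y : ℝ))
      + 4 * ∫ t in Set.Ioi (0 : ℝ), gaussC t * (t * hankelLog y t) := by
  have hd : ∀ t ∈ Set.Ici (0 : ℝ), HasDerivAt (fun t : ℝ => gaussC t * hankelLog y t)
      (-2 * (gaussC t * (t * hankelLog y t)) + gaussC t * hankelKernel (1 / 2) y t) t := by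
    intro t ht
    convert! (hasDerivAt_gaussC t).mul (hasDerivAt_hankelLog hy ht) using 1
    ring
  have hi1 := (integrable_gaussC_mul_hankelLog hy).const_mul (-2)
  have hi2 := integrable_gaussC_mul_hankelKernel (a := 1 / 2) (by norm_num) hy
  have h := integral_Ioi_of_hasDerivAt_of_tendsto' hd (hi1.add hi2)
    (tendsto_gaussC_mul (M := 2 * (2 * y + 8)) 3 fun t ht => by
      have h1 := norm_mul_hankelLog_le hy (by linarith : 0 < t)
      rw [norm_mul, Complex.norm_real, Real.norm_of_nonneg (by linarith)] at h1
      have h2 : (1 : ℝ) ≤ t ^ 3 := one_le_pow₀ ht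
      have h3 := norm_nonneg (hankelLog y t)
      nlinarith)
  rw [integral_add hi1 hi2, integral_const_mul] at h
  -- The logarithm of the principal square root is half the logarithm because halving the argument
  -- keeps it within `(-π, π]`.
  have h0 : hankelLog y 0 = Complex.log (-Complex.I * (2 * y : ℝ)) / 2 := by
    have hne : -Complex.I * ((2 * y : ℝ) : ℂ) ≠ 0 :=
      mul_ne_zero (neg_ne_zero.mpr Complex.I_ne_zero) (by exact_mod_cast (by positivity))
    rw [hankelLog, hankelKernel, show ((0 : ℝ) : ℂ) ^ 2 - 2 * Complex.I * y
      = -Complex.I * (2 * y : ℝ) by push_cast; ring, Complex.ofReal_zero, zero_add,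
      Complex.cpow_def_of_ne_zero hne, Complex.log_exp]
    · push_cast; ring
    all_goals
      have him : (Complex.log (-Complex.I * (2 * y : ℝ)) * ((-(-1 / 2) : ℝ) : ℂ)).im
          = Complex.arg (-Complex.I * (2 * y : ℝ)) / 2 := by
        rw [Complex.im_mul_ofReal, Complex.log_im]; ring
      rw [him]
      linarith [Complex.neg_pi_lt_arg (-Complex.I * (2 * y : ℝ)),
        Complex.arg_le_pi (-Complex.I * (2 * y : ℝ)), Real.pi_pos]
  rw [h0] at h
  simp only [gaussC, Real.exp_zero, ne_eq, OfNat.ofNat_ne_zero, not_false_eq_true, zero_pow,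
    neg_zero, Complex.ofReal_one, one_mul] at h
  simp only [hankelIntegral, gaussC]
  linear_combination 2 * h

/-- The integral is `Γ'(1)`, obtained by differentiating Euler's integral at `1`. This is where
Euler's constant enters the integral representation. -/
lemma integral_log_mul_exp_neg :
    ∫ s in Set.Ioi (0 : ℝ), Real.log s * Real.exp (-s) = -Real.eulerMascheroniConstant := by
  have h1 : HasDerivAt Complex.Gamma _ 1 :=
    (Complex.hasDerivAt_GammaIntegral (s := 1) (by simp)).congr_of_eventuallyEq (by
      have : {s : ℂ | 0 < s.re} ∈ 𝓝 (1 : ℂ) :=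
        (isOpen_lt continuous_const Complex.continuous_re).mem_nhds (by simp)
      filter_upwards [this] with s hs using Complex.Gamma_eq_integral hs)
  have h2 := h1.unique Complex.hasDerivAt_Gamma_one
  simp only [sub_self, Complex.cpow_zero, one_mul] at h2
  rw [← Complex.ofReal_neg] at h2
  apply Complex.ofReal_injective
  rw [← h2, ← integral_complex_ofReal]
  congr 1
  funext s
  push_cast
  rfl

/-- Substituting `s = t²` gives `t log t dt = (1/4) log s ds`. -/
lemma integral_gaussC_mul_log :
    ∫ t in Set.Ioi (0 : ℝ), gaussC t * (t * ((Real.log t : ℝ) : ℂ))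
      = -(Real.eulerMascheroniConstant : ℂ) / 4 := by
  have h := integral_comp_rpow_Ioi_of_pos (g := fun s => Real.log s * Real.exp (-s))
    (p := 2) two_pos
  rw [integral_log_mul_exp_neg] at h
  have h2 : ∫ t in Set.Ioi (0 : ℝ), gaussC t * (t * ((Real.log t : ℝ) : ℂ))
      = ∫ t in Set.Ioi (0 : ℝ), (((1 / 4) * ((2 * t ^ ((2 : ℝ) - 1)) •
        (Real.log (t ^ (2 : ℝ)) * Real.exp (-t ^ (2 : ℝ)))) : ℝ) : ℂ) := by
    refine setIntegral_congr_fun measurableSet_Ioi fun t ht => ?_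
    have e1 : t ^ ((2 : ℝ) - 1) = t := by norm_num
    have e2 : t ^ (2 : ℝ) = t ^ 2 := by norm_num
    simp only [e1, e2, gaussC, Real.log_pow, smul_eq_mul]
    push_cast; ring
  rw [h2, integral_complex_ofReal, integral_const_mul, h]
  push_cast; ring

lemma integrable_gaussC_mul_log :
    IntegrableOn (fun t : ℝ => gaussC t * (t * ((Real.log t : ℝ) : ℂ))) (Set.Ioi 0) := by
  refine integrable_gaussC_mul_of_le (M := 2) 2 ?_ fun t ht => ?_
  · refine Complex.continuous_ofReal.continuousOn.mul
      (Complex.continuous_ofReal.comp_continuousOn ?_)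
    exact Real.continuousOn_log.mono fun t ht => ne_of_gt ht
  · rw [norm_mul, Complex.norm_real, Complex.norm_real, Real.norm_of_nonneg ht.le,
      Real.norm_eq_abs]
    have h1 := Real.one_sub_inv_le_log_of_pos ht
    have h2 := Real.log_le_sub_one_of_pos ht
    have h3 : |Real.log t| ≤ t + t⁻¹ := by
      have hti : 0 < t⁻¹ := inv_pos.mpr ht
      rw [abs_le]
      constructor <;> linarith
    have h4 := mul_le_mul_of_nonneg_left h3 ht.le
    rw [mul_add, mul_inv_cancel₀ ht.ne'] at h4
    nlinarith

lemma integral_gaussC_mul_log_two_mul :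
    ∫ t in Set.Ioi (0 : ℝ), gaussC t * (t * ((Real.log (2 * t) : ℝ) : ℂ))
      = (2 * (Real.log 2 : ℝ) - (Real.eulerMascheroniConstant : ℂ)) / 4 := by
  have hi1 : IntegrableOn (fun t : ℝ => gaussC t * t) (Set.Ioi 0) :=
    integrable_gaussC_mul (M := 1) 1 measurableSet_Ioi
      Complex.continuous_ofReal.continuousOn fun t _ => by simp
  have h : ∫ t in Set.Ioi (0 : ℝ), gaussC t * (t * ((Real.log (2 * t) : ℝ) : ℂ))
      = ∫ t in Set.Ioi (0 : ℝ), ((Real.log 2 : ℝ) * (gaussC t * t)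
        + gaussC t * (t * ((Real.log t : ℝ) : ℂ))) := by
    refine setIntegral_congr_fun measurableSet_Ioi fun t ht => ?_
    rw [Real.log_mul two_ne_zero (ne_of_gt ht)]
    push_cast; ring
  rw [h, integral_add (hi1.const_mul _) integrable_gaussC_mul_log, integral_const_mul,
    integral_mul_gaussC_Ioi, integral_gaussC_mul_log]
  ring

lemma tendsto_hankelLog {t : ℝ} (ht : 0 < t) :
    Tendsto (fun y => hankelLog y t) (𝓝[>] 0) (𝓝 ((Real.log (2 * t) : ℝ) : ℂ)) := by
  have h := (tendsto_hankelKernel (-1 / 2) ht).const_add (t : ℂ)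
  have e : (t : ℂ) + ((t ^ (-2 * (-1 / 2) : ℝ) : ℝ) : ℂ) = ((2 * t : ℝ) : ℂ) := by
    norm_num; ring
  rw [e] at h
  rw [Complex.ofReal_log (by positivity)]
  exact h.clog (Or.inl (by simpa using ht))

/-- The `2 log 2` in the limiting integral compensates `log (2y) = log (y/2) + 2 log 2`, and what
remains is exactly the `γ` of `shiftedLog`. -/
lemma tendsto_hankelIntegral_half_add_shiftedLog :
    Tendsto (fun y : ℝ => hankelIntegral (1 / 2) y + shiftedLog (-Complex.I * y)) (𝓝[>] 0)
      (𝓝 0) := by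
  have h : Tendsto (fun y : ℝ => ∫ t in Set.Ioi (0 : ℝ), gaussC t * (t * hankelLog y t)) (𝓝[>] 0)
      (𝓝 (∫ t in Set.Ioi (0 : ℝ), gaussC t * (t * ((Real.log (2 * t) : ℝ) : ℂ)))) := by
    refine tendsto_integral_filter_of_dominated_convergence
      (fun t => 10 * (t ^ 0 * Real.exp (-t ^ 2) + t ^ 3 * Real.exp (-t ^ 2))) ?_ ?_ ?_ ?_
    · filter_upwards [self_mem_nhdsWithin] with y hy
      exact (integrable_gaussC_mul_hankelLog hy).1
    · filter_upwards [self_mem_nhdsWithin, Ioo_mem_nhdsGT one_pos] with y hy hy1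
      refine (ae_restrict_iff' measurableSet_Ioi).mpr (Eventually.of_forall fun t ht => ?_)
      have ht' : (0 : ℝ) < t := ht
      rw [norm_mul, norm_gaussC]
      have h1 := norm_mul_hankelLog_le hy ht
      have h2 : (2 * y + 8) * (1 + t ^ 3) ≤ 10 * (1 + t ^ 3) := by
        gcongr
        linarith [hy1.2]
      nlinarith [Real.exp_pos (-t ^ 2)]
    · exact (((integrable_pow_mul_exp_neg_sq 0).add (integrable_pow_mul_exp_neg_sq 3)).const_mul
        10).integrableOn
    · refine (ae_restrict_iff' measurableSet_Ioi).mpr (Eventually.of_forall fun t ht => ?_)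
      exact ((tendsto_hankelLog ht).const_mul (t : ℂ)).const_mul (gaussC t)
  rw [integral_gaussC_mul_log_two_mul] at h
  have h2 := (h.const_mul 4).add_const
    ((Real.eulerMascheroniConstant : ℂ) - 2 * ((Real.log 2 : ℝ) : ℂ))
  rw [show 4 * ((2 * ((Real.log 2 : ℝ) : ℂ) - (Real.eulerMascheroniConstant : ℂ)) / 4)
    + ((Real.eulerMascheroniConstant : ℂ) - 2 * ((Real.log 2 : ℝ) : ℂ)) = 0 by ring] at h2
  refine h2.congr' ?_
  filter_upwards [self_mem_nhdsWithin] with y hy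
  have hy' : (0 : ℝ) < y := hy
  have e1 := log_neg_I_mul (x := 2 * y) (by positivity)
  have e2 := log_neg_I_mul (x := y / 2) (by positivity)
  have e3 : Real.log (2 * y) = Real.log (y / 2) + 2 * Real.log 2 := by
    rw [Real.log_mul two_ne_zero hy'.ne', Real.log_div hy'.ne' two_ne_zero]; ring
  have e4 : -Complex.I * (y : ℂ) / 2 = -Complex.I * ((y / 2 : ℝ) : ℂ) := by push_cast; ring
  rw [hankelIntegral_half_eq hy', shiftedLog, e4, e1, e2, ← Complex.ofReal_log (by positivity),
    ← Complex.ofReal_log (by positivity), e3]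
  push_cast
  ring

/-! ### Identification of `K₀` with the integral representation -/

/-- The equation `D'' + D'/y + D = 0` is a damped oscillator, so `|D|² + |D'|²` is nonincreasing in
`y`. Once it is known to tend to `0` at the singular point, it must vanish everywhere. -/
lemma bessel_ode_unique {D D' : ℝ → ℂ} (h1 : ∀ y, 0 < y → HasDerivAt D (D' y) y)
    (h2 : ∀ y, 0 < y → HasDerivAt (fun y : ℝ => y * D' y) (-(y * D y)) y)
    (l1 : Tendsto D (𝓝[>] 0) (𝓝 0))
    (l2 : Tendsto (fun y : ℝ => y * D' y) (𝓝[>] 0) (𝓝 0)) {y : ℝ} (hy : 0 < y) : D y = 0 := by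
  -- The derivative of `y D'` is `-y D`, which has norm at most `y ε/2` near `0`. The mean value
  -- inequality on `[η, y]`, followed by `η → 0`, gives `|y D'| ≤ (ε/2) y²`, so the factor `y` can
  -- be cancelled.
  have l3 : Tendsto D' (𝓝[>] 0) (𝓝 0) := by
    rw [Metric.tendsto_nhds]
    intro ε hε
    have hl := Metric.tendsto_nhds.mp l1 (ε / 2) (by positivity)
    obtain ⟨δ, hδ, hδ'⟩ := mem_nhdsGT_iff_exists_Ioo_subset.mp hl
    have hδ0 : (0 : ℝ) < δ := hδ
    filter_upwards [Ioo_mem_nhdsGT hδ0, Ioo_mem_nhdsGT one_pos] with y hy hy1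
    have hb : ∀ η ∈ Set.Ioo 0 y, ‖(y : ℂ) * D' y - η * D' η‖ ≤ y * (ε / 2) * y := by
      intro η hη
      have := (convex_Icc η y).norm_image_sub_le_of_norm_hasDerivWithin_le
        (f := fun y : ℝ => (y : ℂ) * D' y) (f' := fun y => -(y * D y)) (C := y * (ε / 2))
        (x := η) (y := y)
        (fun s hs => (h2 s (hη.1.trans_le hs.1)).hasDerivWithinAt)
        (fun s hs => by
          have hs0 : 0 < s := hη.1.trans_le hs.1
          have : dist (D s) 0 < ε / 2 := hδ' ⟨hs0, hs.2.trans_lt hy.2⟩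
          rw [dist_zero_right] at this
          rw [norm_neg, norm_mul, Complex.norm_real, Real.norm_of_nonneg hs0.le]
          exact mul_le_mul hs.2 this.le (norm_nonneg _) hy.1.le)
        ⟨le_rfl, hη.2.le⟩ ⟨hη.2.le, le_rfl⟩
      refine this.trans ?_
      rw [Real.norm_of_nonneg (by linarith [hη.2])]
      have := hη.1
      have := hy.1
      gcongr
      linarith
    have hlim : Tendsto (fun η : ℝ => ‖(y : ℂ) * D' y - η * D' η‖) (𝓝[>] 0)
        (𝓝 ‖(y : ℂ) * D' y - 0‖) := (l2.const_sub _).norm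
    have hle := le_of_tendsto hlim
      (by filter_upwards [Ioo_mem_nhdsGT hy.1] with η hη using hb η hη)
    rw [sub_zero, norm_mul, Complex.norm_real, Real.norm_of_nonneg hy.1.le] at hle
    rw [dist_zero_right]
    have h3 : ‖D' y‖ ≤ ε / 2 * y := by
      have h5 : y * ‖D' y‖ ≤ y * (ε / 2 * y) := by linarith
      exact le_of_mul_le_mul_left h5 hy.1
    nlinarith [hy1.2]
  have hE : ∀ y, 0 < y → HasDerivAt (fun y => ‖D y‖ ^ 2 + ‖D' y‖ ^ 2) (-(2 / y * ‖D' y‖ ^ 2)) y := by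
    intro y hy
    have hy0 : (y : ℂ) ≠ 0 := by exact_mod_cast hy.ne'
    have h3 : HasDerivAt D' (-D y - (1 / y : ℝ) • D' y) y := by
      have h4 := ((h2 y hy).div (hasDerivAt_id y).ofReal_comp hy0)
      refine (h4.congr_of_eventuallyEq ?_).congr_deriv ?_
      · filter_upwards [eventually_ne_nhds hy.ne'] with s hs
        have : (s : ℂ) ≠ 0 := by exact_mod_cast hs
        simp [this]
      · simp only [id, Complex.real_smul]
        push_cast
        field_simp
    convert! (h1 y hy).norm_sq.add h3.norm_sq using 1
    rw [inner_sub_right, inner_neg_right, inner_smul_right, real_inner_self_eq_norm_sq,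
      real_inner_comm (D' y) (D y)]
    ring
  have hanti : AntitoneOn (fun y => ‖D y‖ ^ 2 + ‖D' y‖ ^ 2) (Set.Ioi 0) := by
    refine antitoneOn_of_deriv_nonpos (convex_Ioi 0)
      (fun s hs => (hE s hs).continuousAt.continuousWithinAt)
      (fun s hs => (hE s (by simpa using hs)).differentiableAt.differentiableWithinAt) ?_
    intro s hs
    rw [interior_Ioi] at hs
    have hs0 : (0 : ℝ) < s := hs
    rw [(hE s hs).deriv]
    have : 0 ≤ 2 / s * ‖D' s‖ ^ 2 := by positivity
    linarith
  have hlim : Tendsto (fun y => ‖D y‖ ^ 2 + ‖D' y‖ ^ 2) (𝓝[>] 0) (𝓝 0) := by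
    simpa using (l1.norm.pow 2).add (l3.norm.pow 2)
  have hle : ‖D y‖ ^ 2 + ‖D' y‖ ^ 2 ≤ 0 := by
    refine ge_of_tendsto hlim ?_
    filter_upwards [Ioo_mem_nhdsGT hy] with η hη
    exact hanti hη.1 hy hη.2.le
  have : ‖D y‖ ^ 2 = 0 := le_antisymm (by nlinarith [sq_nonneg ‖D' y‖]) (sq_nonneg _)
  simpa using this

/-- The integral representation of `K₀(-iy)`. -/
def hankelRep (y : ℝ) : ℂ := Complex.exp (Complex.I * y) * hankelIntegral (1 / 2) y

/-- The derivative of `hankelRep`. -/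
def hankelRepDeriv (y : ℝ) : ℂ :=
  Complex.I * Complex.exp (Complex.I * y) * (hankelIntegral (1 / 2) y + hankelIntegral (3 / 2) y)

lemma hasDerivAt_exp_I_mul (y : ℝ) :
    HasDerivAt (fun y : ℝ => Complex.exp (Complex.I * y))
      (Complex.I * Complex.exp (Complex.I * y)) y := by
  convert! ((hasDerivAt_id y).ofReal_comp.const_mul Complex.I).cexp using 1
  simp
  ring

lemma hasDerivAt_hankelRep {y : ℝ} (hy : 0 < y) :
    HasDerivAt hankelRep (hankelRepDeriv y) y := by
  have h := (hasDerivAt_exp_I_mul y).mul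
    (hasDerivAt_hankelIntegral (a := 1 / 2) (by norm_num) hy)
  convert! h using 1
  rw [hankelRepDeriv]
  norm_num
  ring

lemma hasDerivAt_mul_hankelRepDeriv {y : ℝ} (hy : 0 < y) :
    HasDerivAt (fun y : ℝ => y * hankelRepDeriv y) (-(y * hankelRep y)) y := by
  have h := (hasDerivAt_id y).ofReal_comp.mul
    (((hasDerivAt_exp_I_mul y).const_mul Complex.I).mul
    ((hasDerivAt_hankelIntegral (a := 1 / 2) (by norm_num) hy).add
      (hasDerivAt_hankelIntegral (a := 3 / 2) (by norm_num) hy)))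
  convert! h using 1
  have hr := hankelIntegral_recurrence hy
  norm_num at hr ⊢
  rw [hankelRep]
  norm_num
  set e := Complex.exp (Complex.I * y)
  linear_combination (-Complex.I * e) * hr
    - (y * e * hankelIntegral (1 / 2) y) * Complex.I_sq

lemma tendsto_mul_shiftedLog :
    Tendsto (fun y : ℝ => (y : ℂ) * shiftedLog (-Complex.I * y)) (𝓝[>] 0) (𝓝 0) := by
  have h1 : Tendsto (fun y : ℝ => ((y / 2 * Real.log (y / 2) : ℝ) : ℂ)) (𝓝[>] 0) (𝓝 0) := by
    have h : Tendsto (fun y : ℝ => y / 2 * Real.log (y / 2)) (𝓝 0) (𝓝 0) := by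
      have := (Real.continuous_mul_log.comp (continuous_id.div_const (2 : ℝ))).tendsto 0
      simpa [Function.comp_def] using this
    have := (Complex.continuous_ofReal.tendsto 0).comp
      (h.mono_left (nhdsWithin_le_nhds (s := Set.Ioi 0)))
    simpa [Function.comp_def] using this
  have h2 : Tendsto (fun y : ℝ => (y : ℂ)) (𝓝[>] 0) (𝓝 0) := by
    have := (Complex.continuous_ofReal.tendsto 0).mono_left (nhdsWithin_le_nhds (s := Set.Ioi 0))
    simpa using this
  have h3 := (h1.const_mul 2).add (h2.mul_const
    (-Complex.I * (Real.pi / 2) + (Real.eulerMascheroniConstant : ℂ)))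
  rw [mul_zero, zero_mul, add_zero] at h3
  refine h3.congr' ?_
  filter_upwards [self_mem_nhdsWithin] with y hy
  have hy' : (0 : ℝ) < y := hy
  have e2 := log_neg_I_mul (x := y / 2) (by positivity)
  have e4 : -Complex.I * (y : ℂ) / 2 = -Complex.I * ((y / 2 : ℝ) : ℂ) := by push_cast; ring
  rw [shiftedLog, e4, e2, ← Complex.ofReal_log (by positivity)]
  push_cast
  ring

lemma tendsto_ofReal_nhdsGT_zero : Tendsto (fun y : ℝ => (y : ℂ)) (𝓝[>] 0) (𝓝 0) := by
  have := (Complex.continuous_ofReal.tendsto 0).mono_left (nhdsWithin_le_nhds (s := Set.Ioi 0))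
  simpa using this

lemma tendsto_powerSum_neg_sq {c : ℕ → ℂ} (hc : EntireCoeff c) :
    Tendsto (fun y : ℝ => powerSum c ((-Complex.I * y) ^ 2 / 4)) (𝓝[>] 0) (𝓝 (c 0)) := by
  have h : Continuous fun y : ℝ => powerSum c ((-Complex.I * y) ^ 2 / 4) :=
    hc.continuous.comp (by fun_prop)
  have := (h.tendsto 0).mono_left (nhdsWithin_le_nhds (s := Set.Ioi 0))
  simpa [powerSum_zero] using this

/-- The `I₀` series is `1 + O(y²)`, which beats the logarithm, and the harmonic series starts at `H₀
= 0`. Hence no constant survives besides the one in `shiftedLog`. -/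
lemma tendsto_besselK0_add_shiftedLog :
    Tendsto (fun y : ℝ => besselK0 (-Complex.I * y) + shiftedLog (-Complex.I * y)) (𝓝[>] 0)
      (𝓝 0) := by
  have h1 := (tendsto_mul_shiftedLog.mul tendsto_ofReal_nhdsGT_zero).mul
    ((tendsto_powerSum_neg_sq entireCoeff_coeffI.shift).const_mul (1 / 4))
  have h2 := h1.add (tendsto_powerSum_neg_sq entireCoeff_coeffK)
  have e0 : coeffK 0 = 0 := by simp [coeffK]
  rw [e0, mul_zero, zero_mul, add_zero] at h2
  refine h2.congr fun y => ?_
  rw [besselK0_eq, entireCoeff_coeffI.powerSum_eq_add ((-Complex.I * y) ^ 2 / 4),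
    show coeffI 0 = 1 by simp [coeffI]]
  linear_combination (shiftedLog (-Complex.I * y) * y ^ 2 *
    powerSum (fun n => coeffI (n + 1)) ((-Complex.I * y) ^ 2 / 4) / 4) * Complex.I_sq

lemma tendsto_mul_besselK1 :
    Tendsto (fun y : ℝ => (-Complex.I * y) * besselK1 (-Complex.I * y)) (𝓝[>] 0) (𝓝 1) := by
  have h1 := (tendsto_mul_shiftedLog.mul tendsto_ofReal_nhdsGT_zero).mul
    ((tendsto_powerSum_neg_sq entireCoeff_nat_mul_coeffI.derivCoeff).const_mul (-1 / 2))
  have h2 := (tendsto_ofReal_nhdsGT_zero.pow 2).mul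
    ((tendsto_powerSum_neg_sq entireCoeff_nat_mul_coeffK.derivCoeff).const_mul (1 / 2))
  have h3 := ((tendsto_powerSum_neg_sq entireCoeff_coeffI).add h1).add h2
  have e0 : coeffI 0 = 1 := by simp [coeffI]
  rw [e0, mul_zero, zero_mul, add_zero, zero_pow two_ne_zero, zero_mul, add_zero] at h3
  refine h3.congr' ?_
  filter_upwards [self_mem_nhdsWithin] with y hy
  have hy' : (y : ℂ) ≠ 0 := by exact_mod_cast (ne_of_gt hy)
  rw [mul_besselK1_eq (mul_ne_zero (neg_ne_zero.mpr Complex.I_ne_zero) hy')]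
  linear_combination (-(shiftedLog (-Complex.I * y) * y ^ 2 *
    powerSum (derivCoeff coeffI) ((-Complex.I * y) ^ 2 / 4) / 2) + y ^ 2 / 2 *
    powerSum (derivCoeff coeffK) ((-Complex.I * y) ^ 2 / 4)) * Complex.I_sq

lemma tendsto_exp_I_sub_one_mul_shiftedLog :
    Tendsto (fun y : ℝ => (Complex.exp (Complex.I * y) - 1) * shiftedLog (-Complex.I * y))
      (𝓝[>] 0) (𝓝 0) := by
  refine squeeze_zero_norm' ?_ (tendsto_zero_iff_norm_tendsto_zero.mp tendsto_mul_shiftedLog)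
  refine Eventually.of_forall fun y => ?_
  rw [norm_mul, norm_mul, Complex.norm_real]
  gcongr
  exact Real.norm_exp_I_mul_ofReal_sub_one_le

lemma tendsto_exp_I_mul : Tendsto (fun y : ℝ => Complex.exp (Complex.I * y)) (𝓝[>] 0) (𝓝 1) := by
  have h : Continuous fun y : ℝ => Complex.exp (Complex.I * y) := by fun_prop
  have := (h.tendsto 0).mono_left (nhdsWithin_le_nhds (s := Set.Ioi 0))
  simpa using this

lemma tendsto_hankelRep_add_shiftedLog :
    Tendsto (fun y : ℝ => hankelRep y + shiftedLog (-Complex.I * y)) (𝓝[>] 0) (𝓝 0) := by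
  have h := (tendsto_exp_I_mul.mul tendsto_hankelIntegral_half_add_shiftedLog).sub
    tendsto_exp_I_sub_one_mul_shiftedLog
  rw [mul_zero, sub_zero] at h
  refine h.congr fun y => ?_
  rw [hankelRep]
  ring

lemma tendsto_mul_hankelRepDeriv :
    Tendsto (fun y : ℝ => y * hankelRepDeriv y) (𝓝[>] 0) (𝓝 (-1)) := by
  have h1 := (tendsto_ofReal_nhdsGT_zero.mul tendsto_hankelIntegral_half_add_shiftedLog).sub
    tendsto_mul_shiftedLog
  have h2 := (tendsto_exp_I_mul.const_mul Complex.I).mul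
    (h1.add tendsto_mul_hankelIntegral_three_halves)
  rw [mul_zero, sub_zero, zero_add, mul_one, Complex.I_mul_I] at h2
  refine h2.congr fun y => ?_
  rw [hankelRepDeriv]
  ring

lemma neg_I_mul_mem_slitPlane {y : ℝ} (hy : 0 < y) : -Complex.I * (y : ℂ) ∈ Complex.slitPlane := by
  right
  simpa using hy.ne'

lemma hasDerivAt_neg_I_mul (y : ℝ) :
    HasDerivAt (fun y : ℝ => -Complex.I * (y : ℂ)) (-Complex.I) y := by
  simpa using (hasDerivAt_id y).ofReal_comp.const_mul (-Complex.I)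

/-- In the difference of the two sides the common singular part `-shiftedLog (-iy)` cancels, and `y`
times either derivative tends to `-1`. The uniqueness lemma therefore applies. -/
theorem besselK0_eq_hankelRep {y : ℝ} (hy : 0 < y) : besselK0 (-Complex.I * y) = hankelRep y := by
  have key := bessel_ode_unique
    (D := fun y : ℝ => besselK0 (-Complex.I * y) - hankelRep y)
    (D' := fun y : ℝ => Complex.I * besselK1 (-Complex.I * y) - hankelRepDeriv y)
    (fun y hy => by
      convert! (HasDerivAt.comp (h := fun y : ℝ => -Complex.I * (y : ℂ)) y
        (hasDerivAt_besselK0 (neg_I_mul_mem_slitPlane hy)) (hasDerivAt_neg_I_mul y)).sub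
        (hasDerivAt_hankelRep hy) using 1
      ring)
    (fun y hy => by
      have h := (HasDerivAt.comp (h := fun y : ℝ => -Complex.I * (y : ℂ)) y
        (hasDerivAt_mul_besselK1 (neg_I_mul_mem_slitPlane hy)) (hasDerivAt_neg_I_mul y)).neg.sub
        (hasDerivAt_mul_hankelRepDeriv hy)
      convert! h using 1
      · funext s
        simp only [Function.comp, Pi.sub_apply, Pi.neg_apply]
        ring
      · linear_combination (-y * besselK0 (-Complex.I * y)) * Complex.I_sq)
    (by
      have h := tendsto_besselK0_add_shiftedLog.sub tendsto_hankelRep_add_shiftedLog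
      rw [sub_zero] at h
      exact h.congr fun y => by ring)
    (by
      have h := tendsto_mul_besselK1.neg.sub tendsto_mul_hankelRepDeriv
      rw [sub_neg_eq_add, neg_add_cancel] at h
      exact h.congr fun y => by ring) hy
  exact sub_eq_zero.mp key

theorem I_mul_besselK1_eq {y : ℝ} (hy : 0 < y) :
    Complex.I * besselK1 (-Complex.I * y) = hankelRepDeriv y := by
  have h1 := HasDerivAt.comp (h := fun y : ℝ => -Complex.I * (y : ℂ)) y
    (hasDerivAt_besselK0 (neg_I_mul_mem_slitPlane hy)) (hasDerivAt_neg_I_mul y)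
  have h2 := (hasDerivAt_hankelRep hy).congr_of_eventuallyEq
    (f₁ := besselK0 ∘ fun y : ℝ => -Complex.I * (y : ℂ))
    ((eventually_gt_nhds hy).mono fun s hs => besselK0_eq_hankelRep hs)
  rw [← h1.unique h2]
  ring

lemma norm_hankelRep_le {y : ℝ} (hy : 0 < y) : ‖hankelRep y‖ ≤ 2 * (2 * y) ^ (-(1 / 2) : ℝ) := by
  rw [hankelRep, norm_mul, mul_comm Complex.I, Complex.norm_exp_ofReal_mul_I, one_mul]
  exact norm_hankelIntegral_le (by norm_num) hy

lemma norm_hankelRep_le_add {y : ℝ} (hy : 0 < y) : ‖hankelRep y‖ ≤ 2 + 1 / y := by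
  refine (norm_hankelRep_le hy).trans ?_
  have hy1 : 0 < 1 / y := by positivity
  rcases le_total 1 (2 * y) with h | h
  · have := Real.rpow_le_one_of_one_le_of_nonpos h (by norm_num : (-(1 / 2) : ℝ) ≤ 0)
    linarith
  · have := Real.rpow_le_rpow_of_exponent_ge (by positivity) h (by norm_num : (-1 : ℝ) ≤ -(1 / 2))
    rw [Real.rpow_neg_one, show (2 * y)⁻¹ = 1 / y / 2 by field_simp] at this
    linarith

lemma norm_hankelRepDeriv_le_add {y : ℝ} (hy : 0 < y) : ‖hankelRepDeriv y‖ ≤ 2 + 2 / y := by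
  have h1 : ‖hankelIntegral (1 / 2) y‖ ≤ 2 + 1 / y := by
    have := norm_hankelRep_le_add hy
    rwa [hankelRep, norm_mul, mul_comm Complex.I, Complex.norm_exp_ofReal_mul_I, one_mul] at this
  have h2 : ‖hankelIntegral (3 / 2) y‖ ≤ 1 / y := by
    have := norm_mul_hankelIntegral_three_halves_le hy
    rw [norm_mul, Complex.norm_real, Real.norm_of_nonneg hy.le] at this
    rw [le_div_iff₀ hy]; linarith
  rw [hankelRepDeriv, norm_mul, norm_mul, Complex.norm_I, one_mul, mul_comm Complex.I,
    Complex.norm_exp_ofReal_mul_I, one_mul]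
  refine (norm_add_le _ _).trans ?_
  rw [show 2 / y = 1 / y + 1 / y by ring]
  linarith

/-- The leading `hankelIntegral (1 / 2)` terms cancel and only the exponent `3/2` is left. This gain
of one power of `y` is the radiation condition. -/
lemma norm_hankelRepDeriv_sub_le {y : ℝ} (hy : 0 < y) :
    ‖hankelRepDeriv y - Complex.I * hankelRep y‖ ≤ 2 * (2 * y) ^ (-(3 / 2) : ℝ) := by
  have : hankelRepDeriv y - Complex.I * hankelRep y
      = Complex.I * (Complex.exp (Complex.I * y) * hankelIntegral (3 / 2) y) := by
    rw [hankelRepDeriv, hankelRep]; ring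
  rw [this, norm_mul, norm_mul, Complex.norm_I, one_mul, mul_comm Complex.I,
    Complex.norm_exp_ofReal_mul_I, one_mul]
  exact norm_hankelIntegral_le (by norm_num) hy

/-! ### Radial kernels in the plane -/

lemma ae_ne_zero : ∀ᵐ u : Plane, u ≠ 0 := by
  rw [ae_iff]; simp

/-- In two dimensions the Jacobian `r` of polar coordinates cancels the singularity `1/r`. -/
lemma locallyIntegrable_one_add_inv_norm :
    LocallyIntegrable (fun u : Plane => 1 + ‖u‖⁻¹) volume := by
  intro x
  refine ⟨Metric.ball 0 (‖x‖ + 1), Metric.isOpen_ball.mem_nhds (by simp), ?_⟩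
  rw [integrableOn_fun_norm_addHaar volume (f := fun r => 1 + r⁻¹)]
  have h : IntegrableOn (fun y : ℝ => y + 1) (Set.Ioo 0 (‖x‖ + 1)) :=
    ((continuous_id.add continuous_const).integrableOn_Icc).mono_set Set.Ioo_subset_Icc_self
  refine h.congr_fun (fun y hy => ?_) measurableSet_Ioo
  have : y ≠ 0 := hy.1.ne'
  simp only [finrank_euclideanSpace, Fintype.card_fin, smul_eq_mul]
  norm_num
  field_simp

lemma locallyIntegrable_of_le_one_add_inv_norm {f : Plane → ℂ} {M : ℝ}
    (hf : ContinuousOn f {0}ᶜ) (hM : ∀ u, u ≠ 0 → ‖f u‖ ≤ M * (1 + ‖u‖⁻¹)) :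
    LocallyIntegrable f volume := by
  have hae : ∀ᵐ u : Plane, u ∈ ({0}ᶜ : Set Plane) := ae_ne_zero
  refine (locallyIntegrable_one_add_inv_norm.smul M).mono ?_ ?_
  · have := hf.aestronglyMeasurable (μ := volume) (measurableSet_singleton (0 : Plane)).compl
    rwa [Measure.restrict_eq_self_of_ae_mem hae] at this
  · filter_upwards [hae] with u hu
    refine (hM u hu).trans ?_
    simpa using le_abs_self (M * (1 + ‖u‖⁻¹))

/-- A radial profile `g` with derivative `g'` satisfying `(r g')' + κ r g = 0`, at most as
singular as `1 / r` together with its derivative, and with `r g'(r) → c` as `r → 0`. -/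
structure IsSingularProfile (g g' : ℝ → ℂ) (κ c : ℂ) (M : ℝ) : Prop where
  hasDerivAt : ∀ r, 0 < r → HasDerivAt g (g' r) r
  hasDerivAt_mul : ∀ r, 0 < r → HasDerivAt (fun r : ℝ => r * g' r) (-(κ * (r * g r))) r
  norm_le : ∀ r, 0 < r → ‖g r‖ ≤ M * (1 + r⁻¹)
  norm_deriv_le : ∀ r, 0 < r → ‖g' r‖ ≤ M * (1 + r⁻¹)
  tendsto : Tendsto (fun r : ℝ => r * g' r) (𝓝[>] 0) (𝓝 c)

namespace IsSingularProfile

variable {g g' : ℝ → ℂ} {κ c : ℂ} {M : ℝ}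

lemma nonneg (h : IsSingularProfile g g' κ c M) : 0 ≤ M := by
  have := (norm_nonneg _).trans (h.norm_le 1 one_pos)
  norm_num at this
  linarith

lemma continuousOn (h : IsSingularProfile g g' κ c M) : ContinuousOn g (Set.Ioi 0) :=
  fun r hr => (h.hasDerivAt r hr).continuousAt.continuousWithinAt

lemma continuousOn_deriv (h : IsSingularProfile g g' κ c M) : ContinuousOn g' (Set.Ioi 0) := by
  have h1 : ContinuousOn (fun r : ℝ => r * g' r) (Set.Ioi 0) :=
    fun r hr => (h.hasDerivAt_mul r hr).continuousAt.continuousWithinAt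
  have h2 : ContinuousOn (fun r : ℝ => (r : ℂ)⁻¹) (Set.Ioi 0) :=
    Complex.continuous_ofReal.continuousOn.inv₀ fun r hr => by
      exact_mod_cast (ne_of_gt hr)
  refine (h2.mul h1).congr fun r hr => ?_
  have : (r : ℂ) ≠ 0 := by exact_mod_cast (ne_of_gt hr)
  simp only [Pi.mul_apply]
  field_simp

lemma locallyIntegrable (h : IsSingularProfile g g' κ c M) :
    LocallyIntegrable (fun u : Plane => g ‖u‖) volume :=
  locallyIntegrable_of_le_one_add_inv_norm
    (h.continuousOn.comp continuous_norm.continuousOn fun _ hu => norm_pos_iff.mpr hu)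
    fun _ hu => h.norm_le _ (norm_pos_iff.mpr hu)

lemma abs_inner_div_norm_le (u e : Plane) : |inner ℝ u e / ‖u‖| ≤ ‖e‖ := by
  rw [abs_div, abs_norm]
  exact div_le_of_le_mul₀ (norm_nonneg _) (norm_nonneg _)
    ((abs_real_inner_le_norm u e).trans (mul_comm _ _).le)

lemma locallyIntegrable_deriv (h : IsSingularProfile g g' κ c M) (e : Plane) :
    LocallyIntegrable (fun u : Plane => ((inner ℝ u e / ‖u‖ : ℝ) : ℂ) * g' ‖u‖) volume := by
  refine locallyIntegrable_of_le_one_add_inv_norm (M := ‖e‖ * M) ?_ fun u hu => ?_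
  · refine ContinuousOn.mul (Complex.continuous_ofReal.comp_continuousOn ?_)
      (h.continuousOn_deriv.comp continuous_norm.continuousOn fun _ hu => norm_pos_iff.mpr hu)
    exact ContinuousOn.div (by fun_prop) (by fun_prop) fun _ hu => norm_ne_zero_iff.mpr hu
  · rw [norm_mul, Complex.norm_real, Real.norm_eq_abs, mul_assoc]
    exact mul_le_mul (abs_inner_div_norm_le u e) (h.norm_deriv_le _ (norm_pos_iff.mpr hu))
      (norm_nonneg _) (norm_nonneg _)

lemma hasLineDerivAt_sqrt_norm_sq_add {ε : ℝ} (hε : 0 < ε) (u e : Plane) :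
    HasLineDerivAt ℝ (fun u : Plane => √(‖u‖ ^ 2 + ε)) (inner ℝ u e / √(‖u‖ ^ 2 + ε)) u e := by
  have h1 : HasDerivAt (fun t : ℝ => u + t • e) e 0 := by
    simpa using ((hasDerivAt_id (0 : ℝ)).smul_const e).const_add u
  have h2 := ((h1.norm_sq).add_const ε).sqrt (by positivity)
  simp only [zero_smul, add_zero] at h2
  rw [mul_div_mul_left _ _ two_ne_zero] at h2
  exact h2

/-- Integration by parts against a regularization of a singular profile. -/
lemma integral_regularized (h : IsSingularProfile g g' κ c M) {ψ : Plane → ℂ}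
    (hψ : ContDiff ℝ 1 ψ) (hc : HasCompactSupport ψ) (e : Plane) {ε : ℝ} (hε : 0 < ε) :
    ∫ u, g (√(‖u‖ ^ 2 + ε)) * fderiv ℝ ψ u e
      = -∫ u, ((inner ℝ u e / √(‖u‖ ^ 2 + ε) : ℝ) : ℂ) * g' (√(‖u‖ ^ 2 + ε)) * ψ u := by
  have hpos : ∀ u : Plane, 0 < √(‖u‖ ^ 2 + ε) := fun u => by positivity
  have hcont : Continuous fun u : Plane => √(‖u‖ ^ 2 + ε) := by fun_prop
  have hg : Continuous fun u : Plane => g (√(‖u‖ ^ 2 + ε)) :=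
    h.continuousOn.comp_continuous hcont hpos
  have hg' : Continuous fun u : Plane => g' (√(‖u‖ ^ 2 + ε)) :=
    h.continuousOn_deriv.comp_continuous hcont hpos
  have hi : Continuous fun u : Plane => ((inner ℝ u e / √(‖u‖ ^ 2 + ε) : ℝ) : ℂ) :=
    Complex.continuous_ofReal.comp
      (Continuous.div (by fun_prop) hcont fun u => (hpos u).ne')
  have hdψ : Continuous fun u => fderiv ℝ ψ u e :=
    (hψ.continuous_fderiv one_ne_zero).clm_apply continuous_const
  have hcd : HasCompactSupport fun u => fderiv ℝ ψ u e := hc.fderiv_apply ℝ e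
  exact integral_bilinear_hasLineDerivAt_right_eq_neg_left_of_integrable
    (B := ContinuousLinearMap.mul ℝ ℂ) (v := e)
    (f := fun u : Plane => g (√(‖u‖ ^ 2 + ε)))
    (f' := fun u : Plane => ((inner ℝ u e / √(‖u‖ ^ 2 + ε) : ℝ) : ℂ) * g' (√(‖u‖ ^ 2 + ε)))
    (g := ψ) (g' := fun u => fderiv ℝ ψ u e)
    (((hi.mul hg').mul hψ.continuous).integrable_of_hasCompactSupport hc.mul_left)
    ((hg.mul hdψ).integrable_of_hasCompactSupport hcd.mul_left)
    ((hg.mul hψ.continuous).integrable_of_hasCompactSupport hc.mul_left)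
    (fun u _ => by
      have h1 := hasLineDerivAt_sqrt_norm_sq_add hε u e
      have h2 : HasDerivAt g (g' (√(‖u + (0 : ℝ) • e‖ ^ 2 + ε))) (√(‖u + (0 : ℝ) • e‖ ^ 2 + ε)) :=
        h.hasDerivAt _ (hpos _)
      have h3 := HasDerivAt.scomp (h := fun t : ℝ => √(‖u + t • e‖ ^ 2 + ε)) 0 h2 h1
      simp only [zero_smul, add_zero, Complex.real_smul] at h3
      exact h3)
    (fun u _ => (hψ.differentiable one_ne_zero u).hasFDerivAt.hasLineDerivAt e)

lemma sqrt_tendsto (u : Plane) :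
    Tendsto (fun ε : ℝ => √(‖u‖ ^ 2 + ε)) (𝓝[>] 0) (𝓝 ‖u‖) := by
  have h : Continuous fun ε : ℝ => √(‖u‖ ^ 2 + ε) := by fun_prop
  have := (h.tendsto 0).mono_left (nhdsWithin_le_nhds (s := Set.Ioi 0))
  simpa using this

lemma norm_le_sqrt (u : Plane) {ε : ℝ} (hε : 0 < ε) : ‖u‖ ≤ √(‖u‖ ^ 2 + ε) :=
  Real.le_sqrt_of_sq_le (by linarith)

lemma one_add_inv_le {M r s : ℝ} (hM : 0 ≤ M) (hr : 0 < r) (hrs : r ≤ s) :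
    M * (1 + s⁻¹) ≤ M * (1 + r⁻¹) := by
  gcongr

/-- The distributional gradient of a singular profile is its pointwise gradient. -/
lemma integral_mul_fderiv (h : IsSingularProfile g g' κ c M) {ψ : Plane → ℂ}
    (hψ : ContDiff ℝ 1 ψ) (hc : HasCompactSupport ψ) (e : Plane) :
    ∫ u, g ‖u‖ * fderiv ℝ ψ u e
      = -∫ u, ((inner ℝ u e / ‖u‖ : ℝ) : ℂ) * g' ‖u‖ * ψ u := by
  have hdψ : Continuous fun u => fderiv ℝ ψ u e :=
    (hψ.continuous_fderiv one_ne_zero).clm_apply continuous_const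
  have hcd : HasCompactSupport fun u => fderiv ℝ ψ u e := hc.fderiv_apply ℝ e
  have hM := h.nonneg
  have hcont : ∀ ε : ℝ, Continuous fun u : Plane => √(‖u‖ ^ 2 + ε) := fun ε => by fun_prop
  -- Since `‖u‖ ≤ √(‖u‖² + ε)` and `1 + 1/s` decreases in `s`, the bound at `ε = 0` dominates for
  -- all `ε > 0`.
  have l1 : Tendsto (fun ε : ℝ => ∫ u, g (√(‖u‖ ^ 2 + ε)) * fderiv ℝ ψ u e) (𝓝[>] 0)
      (𝓝 (∫ u, g ‖u‖ * fderiv ℝ ψ u e)) := by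
    refine tendsto_integral_filter_of_dominated_convergence
      (fun u => ‖fderiv ℝ ψ u e‖ • (M * (1 + ‖u‖⁻¹))) ?_ ?_ ?_ ?_
    · filter_upwards [self_mem_nhdsWithin] with ε hε
      have hε' : (0 : ℝ) < ε := hε
      exact ((h.continuousOn.comp_continuous (hcont ε)
        fun u => (by positivity : 0 < √(‖u‖ ^ 2 + ε))).mul hdψ).aestronglyMeasurable
    · filter_upwards [self_mem_nhdsWithin] with ε hε
      filter_upwards [ae_ne_zero] with u hu
      have hu0 := norm_pos_iff.mpr hu
      have hle := norm_le_sqrt u hε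
      rw [norm_mul, mul_comm, smul_eq_mul]
      gcongr
      exact (h.norm_le _ (hu0.trans_le hle)).trans (one_add_inv_le hM hu0 hle)
    · exact (locallyIntegrable_one_add_inv_norm.smul M).integrable_smul_left_of_hasCompactSupport
        hdψ.norm hcd.norm
    · filter_upwards [ae_ne_zero] with u hu
      exact ((h.hasDerivAt _ (norm_pos_iff.mpr hu)).continuousAt.tendsto.comp
        (sqrt_tendsto u)).mul_const _
  have l2 : Tendsto (fun ε : ℝ => ∫ u, ((inner ℝ u e / √(‖u‖ ^ 2 + ε) : ℝ) : ℂ)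
      * g' (√(‖u‖ ^ 2 + ε)) * ψ u) (𝓝[>] 0)
      (𝓝 (∫ u, ((inner ℝ u e / ‖u‖ : ℝ) : ℂ) * g' ‖u‖ * ψ u)) := by
    refine tendsto_integral_filter_of_dominated_convergence
      (fun u => ‖ψ u‖ • (‖e‖ * M * (1 + ‖u‖⁻¹))) ?_ ?_ ?_ ?_
    · filter_upwards [self_mem_nhdsWithin] with ε hε
      have hε' : (0 : ℝ) < ε := hε
      have hpos : ∀ u : Plane, 0 < √(‖u‖ ^ 2 + ε) := fun u => by positivity
      refine (((Complex.continuous_ofReal.comp (Continuous.div (by fun_prop) (hcont ε)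
        fun u => (hpos u).ne')).mul (h.continuousOn_deriv.comp_continuous (hcont ε)
        hpos)).mul hψ.continuous).aestronglyMeasurable
    · filter_upwards [self_mem_nhdsWithin] with ε hε
      filter_upwards [ae_ne_zero] with u hu
      have hu0 := norm_pos_iff.mpr hu
      have hle := norm_le_sqrt u hε
      rw [norm_mul, mul_comm, smul_eq_mul, norm_mul, Complex.norm_real, Real.norm_eq_abs,
        mul_assoc ‖e‖]
      gcongr
      · rw [abs_div, abs_of_nonneg (Real.sqrt_nonneg _)]
        refine div_le_of_le_mul₀ (Real.sqrt_nonneg _) (norm_nonneg _)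
          ((abs_real_inner_le_norm u e).trans ?_)
        rw [mul_comm]
        gcongr
      · exact (h.norm_deriv_le _ (hu0.trans_le hle)).trans (one_add_inv_le hM hu0 hle)
    · exact (locallyIntegrable_one_add_inv_norm.smul
        (‖e‖ * M)).integrable_smul_left_of_hasCompactSupport hψ.continuous.norm hc.norm
    · filter_upwards [ae_ne_zero] with u hu
      have hu0 := norm_pos_iff.mpr hu
      have hc1 : ContinuousAt g' ‖u‖ := h.continuousOn_deriv.continuousAt (Ioi_mem_nhds hu0)
      refine Tendsto.mul_const _ (Tendsto.mul ?_ (hc1.tendsto.comp (sqrt_tendsto u)))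
      exact (Complex.continuous_ofReal.tendsto _).comp
        (tendsto_const_nhds.div (sqrt_tendsto u) hu0.ne')
  refine tendsto_nhds_unique l1 (l2.neg.congr' ?_)
  filter_upwards [self_mem_nhdsWithin] with ε hε
  exact (h.integral_regularized hψ hc e hε).symm

end IsSingularProfile

/-! ### Integration in polar coordinates -/

lemma integrable_polar {f : Plane → ℂ} (hf : Integrable f) :
    Integrable (fun p : Metric.sphere (0 : Plane) 1 × Set.Ioi (0 : ℝ) => f (p.2.1 • p.1.1))
      ((volume : Measure Plane).toSphere.prod (Measure.volumeIoiPow 1)) := by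
  have h := (volume : Measure Plane).measurePreserving_homeomorphUnitSphereProd
  rw [show Module.finrank ℝ Plane - 1 = 1 by simp] at h
  rw [← h.integrable_comp_emb (Homeomorph.measurableEmbedding _)]
  have h2 : Integrable (fun x : ({(0 : Plane)}ᶜ : Set Plane) => f x.1)
      (volume.comap Subtype.val) :=
    (integrableOn_iff_comap_subtypeVal (measurableSet_singleton _).compl).mp hf.integrableOn
  refine h2.congr (Eventually.of_forall fun x => ?_)
  have hx : ‖x.1‖ ≠ 0 := norm_ne_zero_iff.mpr x.2
  simp [smul_smul, hx]

/-- Removing the null set `{0}` identifies the plane with circle times half-line, with radial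
density `r ^ (2 - 1)`; Fubini then separates the variables. -/
lemma integral_polar {f : Plane → ℂ} (hf : Integrable f) :
    ∫ u, f u = ∫ σ : Metric.sphere (0 : Plane) 1,
      (∫ r in Set.Ioi (0 : ℝ), (r : ℂ) * f (r • σ.1)) ∂(volume : Measure Plane).toSphere := by
  have h := (volume : Measure Plane).measurePreserving_homeomorphUnitSphereProd
  rw [show Module.finrank ℝ Plane - 1 = 1 by simp] at h
  calc ∫ u, f u = ∫ x : ({(0 : Plane)}ᶜ : Set Plane), f x.1 ∂(volume.comap Subtype.val) := by
        rw [integral_subtype_comap (measurableSet_singleton _).compl f,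
          restrict_compl_singleton]
    _ = ∫ p, f (p.2.1 • p.1.1)
          ∂((volume : Measure Plane).toSphere.prod (Measure.volumeIoiPow 1)) := by
        rw [← h.integral_comp (Homeomorph.measurableEmbedding _)]
        refine integral_congr_ae (Eventually.of_forall fun x => ?_)
        have hx : ‖x.1‖ ≠ 0 := norm_ne_zero_iff.mpr x.2
        simp [smul_smul, hx]
    _ = ∫ σ, (∫ r, f (r.1 • σ.1) ∂(Measure.volumeIoiPow 1))
          ∂(volume : Measure Plane).toSphere := integral_prod _ (integrable_polar hf)
    _ = _ := by
        refine integral_congr_ae (Eventually.of_forall fun σ => ?_)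
        simp only [Measure.volumeIoiPow, ENNReal.ofReal]
        rw [integral_withDensity_eq_integral_smul
            (measurable_subtype_coe.pow_const _).real_toNNReal,
          integral_subtype_comap measurableSet_Ioi
            fun r : ℝ => Real.toNNReal (r ^ 1) • f (r • σ.1)]
        refine setIntegral_congr_fun measurableSet_Ioi fun r hr => ?_
        simp only [pow_one]
        rw [NNReal.smul_def, Real.coe_toNNReal _ (le_of_lt hr), Complex.real_smul]

lemma toSphere_real_univ :
    ((volume : Measure Plane).toSphere).real Set.univ = 2 * Real.pi := by
  rw [Measure.toSphere_real_apply_univ, measureReal_def, EuclideanSpace.volume_ball_fin_two]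
  simp [Real.pi_pos.le]

/-! ### Fundamental solutions of the Helmholtz equation -/

lemma laplacian_eq_sum_fderiv {φ : Plane → ℂ} (hφ : ContDiff ℝ 2 φ) (x : Plane) :
    Laplacian.laplacian φ x = ∑ i : Fin 2, fderiv ℝ
      (fun y => fderiv ℝ φ y (EuclideanSpace.single i 1)) x (EuclideanSpace.single i 1) := by
  rw [InnerProductSpace.laplacian_eq_iteratedFDeriv_orthonormalBasis φ
    (EuclideanSpace.basisFun (Fin 2) ℝ)]
  refine Finset.sum_congr rfl fun i _ => ?_
  have hd : DifferentiableAt ℝ (fderiv ℝ φ) x :=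
    (hφ.fderiv_right (m := 1) (by norm_num)).differentiable one_ne_zero x
  rw [iteratedFDeriv_two_apply, fderiv_clm_apply hd (differentiableAt_const _)]
  simp

/-- The gradient of a radial function pairs with `∇φ` only through `u · ∇φ`, which becomes the
derivative of `φ` along the ray. -/
lemma sum_inner_mul_fderiv (φ : Plane → ℂ) (u : Plane) :
    ∑ i : Fin 2, ((inner ℝ u (EuclideanSpace.single i (1 : ℝ)) : ℝ) : ℂ) *
      fderiv ℝ φ u (EuclideanSpace.single i 1) = fderiv ℝ φ u u := by
  have hu : u = ∑ i : Fin 2, u i • EuclideanSpace.single i (1 : ℝ) := by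
    ext j
    fin_cases j <;> simp
  have hs : fderiv ℝ φ u u = fderiv ℝ φ u (∑ i : Fin 2, u i • EuclideanSpace.single i (1 : ℝ)) :=
    congrArg _ hu
  rw [hs, map_sum]
  refine Finset.sum_congr rfl fun i _ => ?_
  rw [map_smul, Complex.real_smul, EuclideanSpace.inner_single_right]
  simp

namespace IsSingularProfile

variable {g g' : ℝ → ℂ} {κ c : ℂ} {M : ℝ}

/-- The radial part of the computation: `∫₀^∞ r (κ g η - g' ∂ᵣη) dr` along a ray. -/
lemma integral_ray (h : IsSingularProfile g g' κ c M) {η : ℝ → ℂ} (hη : ContDiff ℝ 1 η)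
    (hc : HasCompactSupport η) :
    ∫ r in Set.Ioi (0 : ℝ), (r : ℂ) * (κ * (g r * η r) - g' r * deriv η r) = c * η 0 := by
  have hd : Continuous (deriv η) := hη.continuous_deriv le_rfl
  have hM := h.nonneg
  have hI : IntegrableOn (fun r : ℝ => -(κ * (r * g r)) * η r + r * g' r * deriv η r)
      (Set.Ioi 0) := by
    have hb : Continuous fun r : ℝ => M * (|r| + 1) * (‖κ‖ * ‖η r‖ + ‖deriv η r‖) := by
      have := hη.continuous
      fun_prop
    have hbs : HasCompactSupport fun r : ℝ => M * (|r| + 1) * (‖κ‖ * ‖η r‖ + ‖deriv η r‖) :=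
      (hc.norm.mul_left.add hc.deriv.norm).mul_left
    refine Integrable.mono' (hb.integrable_of_hasCompactSupport hbs).integrableOn ?_ ?_
    · refine ContinuousOn.aestronglyMeasurable ?_ measurableSet_Ioi
      exact (((continuousOn_const.mul (Complex.continuous_ofReal.continuousOn.mul
        h.continuousOn)).neg.mul hη.continuous.continuousOn)).add
        ((Complex.continuous_ofReal.continuousOn.mul h.continuousOn_deriv).mul hd.continuousOn)
    · refine (ae_restrict_iff' measurableSet_Ioi).mpr (Eventually.of_forall fun r hr => ?_)
      have hr0 : (0 : ℝ) < r := hr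
      have e : r * (M * (1 + r⁻¹)) = M * (r + 1) := by field_simp
      have h1 : r * ‖g r‖ ≤ M * (r + 1) := e ▸ mul_le_mul_of_nonneg_left (h.norm_le r hr0) hr0.le
      have h2 : r * ‖g' r‖ ≤ M * (r + 1) :=
        e ▸ mul_le_mul_of_nonneg_left (h.norm_deriv_le r hr0) hr0.le
      refine (norm_add_le _ _).trans ?_
      rw [norm_mul, norm_neg, norm_mul, norm_mul, norm_mul, norm_mul, Complex.norm_real,
        Real.norm_of_nonneg hr0.le, abs_of_pos hr0]
      have h3 := mul_le_mul_of_nonneg_right h1 (mul_nonneg (norm_nonneg κ) (norm_nonneg (η r)))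
      have h4 := mul_le_mul_of_nonneg_right h2 (norm_nonneg (deriv η r))
      linarith
  have h0 : Tendsto (fun r : ℝ => r * g' r * η r) (𝓝[>] 0) (𝓝 (c * η 0)) :=
    h.tendsto.mul ((hη.continuous.tendsto 0).mono_left nhdsWithin_le_nhds)
  have hinf : Tendsto (fun r : ℝ => r * g' r * η r) atTop (𝓝 0) := by
    obtain ⟨R, hR⟩ := hc.isCompact.isBounded.subset_closedBall 0
    refine tendsto_const_nhds.congr' ?_
    filter_upwards [eventually_gt_atTop R, eventually_gt_atTop 0] with r hr hr0
    have : r ∉ tsupport η := fun hmem => by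
      have := hR hmem
      rw [mem_closedBall_zero_iff, Real.norm_of_nonneg hr0.le] at this
      linarith
    rw [image_eq_zero_of_notMem_tsupport this, mul_zero]
  -- By the radial equation the integrand is minus the derivative of `r g' η`; only the boundary
  -- value at `0` contributes.
  have key := integral_Ioi_deriv_mul_eq_sub (a := 0) (u := fun r : ℝ => r * g' r) (v := η)
    (fun r hr => h.hasDerivAt_mul r hr)
    (fun r _ => (hη.differentiable one_ne_zero r).hasDerivAt) hI h0 hinf
  rw [zero_sub] at key
  rw [← neg_eq_iff_eq_neg.mpr key, ← integral_neg]
  refine integral_congr_ae (Eventually.of_forall fun r => ?_)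
  simp only
  ring

/-- A singular profile is, up to normalization, a fundamental solution of `Δ + κ`. -/
theorem integral_laplacian_origin (h : IsSingularProfile g g' κ c M) {φ : Plane → ℂ}
    (hφ : ContDiff ℝ (⊤ : ℕ∞) φ) (hc : HasCompactSupport φ) :
    (∫ u, g ‖u‖ * Laplacian.laplacian φ u) + κ * ∫ u, g ‖u‖ * φ u
      = 2 * Real.pi * c * φ 0 := by
  set e : Fin 2 → Plane := fun i => EuclideanSpace.single i 1 with he
  have hφ2 : ContDiff ℝ 2 φ := contDiff_infty.mp hφ 2
  have hφ1 : ContDiff ℝ 1 φ := hφ2.of_le one_le_two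
  have hψ : ∀ i, ContDiff ℝ 1 fun y => fderiv ℝ φ y (e i) := fun i =>
    (hφ2.fderiv_right (m := 1) (by norm_num)).clm_apply contDiff_const
  have hψc : ∀ i, HasCompactSupport fun y => fderiv ℝ φ y (e i) := fun i => hc.fderiv_apply ℝ _
  have hg := h.locallyIntegrable
  have hint : ∀ {f : Plane → ℂ} {ψ : Plane → ℂ}, LocallyIntegrable f volume → Continuous ψ →
      HasCompactSupport ψ → Integrable fun u => f u * ψ u := fun hf hψ hψc => by
    simpa only [smul_eq_mul] using hf.integrable_smul_right_of_hasCompactSupport hψ hψc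
  have hi1 : ∀ i, Integrable fun u => g ‖u‖ * fderiv ℝ (fun y => fderiv ℝ φ y (e i)) u (e i) :=
    fun i => hint hg (((hψ i).continuous_fderiv one_ne_zero).clm_apply continuous_const)
      ((hψc i).fderiv_apply ℝ _)
  have hi2 : ∀ i, Integrable fun u : Plane =>
      ((inner ℝ u (e i) / ‖u‖ : ℝ) : ℂ) * g' ‖u‖ * fderiv ℝ φ u (e i) :=
    fun i => hint (h.locallyIntegrable_deriv (e i)) (hψ i).continuous (hψc i)
  have hi3 : Integrable fun u => g ‖u‖ * φ u := hint hg hφ.continuous hc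
  set f : Plane → ℂ := fun u => κ * (g ‖u‖ * φ u)
    - ∑ i, ((inner ℝ u (e i) / ‖u‖ : ℝ) : ℂ) * g' ‖u‖ * fderiv ℝ φ u (e i) with hf
  have hfi : Integrable f := (hi3.const_mul κ).sub (integrable_finsetSum _ fun i _ => hi2 i)
  have e1 : (∫ u, g ‖u‖ * Laplacian.laplacian φ u) + κ * ∫ u, g ‖u‖ * φ u = ∫ u, f u := by
    rw [hf, integral_sub (hi3.const_mul κ) (integrable_finsetSum _ fun i _ => hi2 i),
      integral_finsetSum _ fun i _ => hi2 i, integral_const_mul, sub_eq_add_neg, add_comm,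
      ← Finset.sum_neg_distrib]
    congr 1
    simp_rw [laplacian_eq_sum_fderiv hφ2, Finset.mul_sum]
    rw [integral_finsetSum _ fun i _ => hi1 i]
    exact Finset.sum_congr rfl fun i _ => h.integral_mul_fderiv (hψ i) (hψc i) (e i)
  have hfe : ∀ u : Plane, f u = κ * (g ‖u‖ * φ u) - g' ‖u‖ * ((‖u‖⁻¹ : ℝ) * fderiv ℝ φ u u) := by
    intro u
    rw [hf]
    simp only
    rw [← sum_inner_mul_fderiv φ u, Finset.mul_sum, Finset.mul_sum]
    congr 1
    refine Finset.sum_congr rfl fun i _ => ?_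
    rw [div_eq_mul_inv, Complex.ofReal_mul]
    ring
  rw [e1, integral_polar hfi]
  -- Every ray gives the same value, so the outer integral is just multiplication by the length `2π`
  -- of the circle.
  have e2 : ∀ σ : Metric.sphere (0 : Plane) 1,
      ∫ r in Set.Ioi (0 : ℝ), (r : ℂ) * f (r • σ.1) = c * φ 0 := by
    intro σ
    have hσ : ‖σ.1‖ = 1 := by simp
    have hη : ContDiff ℝ 1 fun r : ℝ => φ (r • σ.1) :=
      hφ1.comp (contDiff_id.smul contDiff_const)
    have hηc : HasCompactSupport fun r : ℝ => φ (r • σ.1) := by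
      refine hc.comp_isClosedEmbedding (g := fun r : ℝ => r • σ.1) ?_
      refine (Isometry.of_dist_eq fun a b => ?_).isClosedEmbedding
      rw [dist_eq_norm, ← sub_smul, norm_smul, hσ, mul_one, dist_eq_norm]
    have hr := h.integral_ray hη hηc
    simp only [zero_smul] at hr
    rw [← hr]
    refine setIntegral_congr_fun measurableSet_Ioi fun r hr => ?_
    have hr0 : (0 : ℝ) < r := hr
    have hn : ‖r • σ.1‖ = r := by rw [norm_smul, hσ, mul_one, Real.norm_of_nonneg hr0.le]
    have hd : HasDerivAt (fun r : ℝ => φ (r • σ.1)) (fderiv ℝ φ (r • σ.1) σ.1) r := by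
      have h1 : HasDerivAt (fun r : ℝ => r • σ.1) σ.1 r := by
        simpa using (hasDerivAt_id r).smul_const σ.1
      exact ((hφ1.differentiable one_ne_zero _).hasFDerivAt).comp_hasDerivAt r h1
    have hr0' : (r : ℂ) ≠ 0 := by exact_mod_cast hr0.ne'
    rw [hfe, hn, hd.deriv, map_smul, Complex.real_smul, Complex.ofReal_inv,
      inv_mul_cancel_left₀ hr0']
  simp_rw [e2]
  rw [integral_const, toSphere_real_univ, Complex.real_smul]
  push_cast
  ring

theorem integral_laplacian (h : IsSingularProfile g g' κ c M) {φ : Plane → ℂ}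
    (hφ : ContDiff ℝ (⊤ : ℕ∞) φ) (hc : HasCompactSupport φ) (ξ : Plane) :
    (∫ x, g (dist x ξ) * Laplacian.laplacian φ x) + κ * ∫ x, g (dist x ξ) * φ x
      = 2 * Real.pi * c * φ ξ := by
  have hη : ContDiff ℝ (⊤ : ℕ∞) fun u => φ (ξ + u) := hφ.comp (contDiff_const.add contDiff_id)
  have hηc : HasCompactSupport fun u => φ (ξ + u) :=
    hc.comp_homeomorph (Homeomorph.addLeft ξ)
  have key := h.integral_laplacian_origin hη hηc
  rw [add_zero] at key
  rw [← key, ← integral_add_left_eq_self _ ξ,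
    ← integral_add_left_eq_self (fun x => g (dist x ξ) * φ x) ξ]
  simp only [dist_self_add_left]
  congr 1
  refine integral_congr_ae (Eventually.of_forall fun u => ?_)
  simp only
  congr 1
  simp only [InnerProductSpace.laplacian_eq_iteratedFDeriv_stdOrthonormalBasis,
    iteratedFDeriv_comp_add_left]

lemma locallyIntegrable_dist (h : IsSingularProfile g g' κ c M) (ξ : Plane) :
    LocallyIntegrable (fun x : Plane => g (dist x ξ)) volume := by
  intro x
  obtain ⟨s, hs, hi⟩ := h.locallyIntegrable (x - ξ)
  refine ⟨(fun y => y - ξ) ⁻¹' s,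
    (continuous_id.sub continuous_const).continuousAt.preimage_mem_nhds hs, ?_⟩
  have := (measurePreserving_sub_right (volume : Measure Plane) ξ).integrableOn_comp_preimage
    (MeasurableEquiv.subRight ξ).measurableEmbedding |>.mpr hi
  simpa only [Function.comp_def, ← dist_eq_norm] using this

end IsSingularProfile

/-! ### The material matrix -/

section Material

variable {c44 R3 K2 : ℝ}

lemma quadratic_pos (hc : 0 < c44) (hdet : 0 < c44 * K2 - R3 ^ 2) {x y : ℝ}
    (hxy : x ≠ 0 ∨ y ≠ 0) : 0 < c44 * x ^ 2 + 2 * R3 * x * y + K2 * y ^ 2 := by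
  refine pos_of_mul_pos_right (a := c44) ?_ hc.le
  rw [show c44 * (c44 * x ^ 2 + 2 * R3 * x * y + K2 * y ^ 2)
    = (c44 * x + R3 * y) ^ 2 + (c44 * K2 - R3 ^ 2) * y ^ 2 by ring]
  rcases eq_or_ne y 0 with rfl | hy
  · have hx : x ≠ 0 := by simpa using hxy
    have : 0 < (c44 * x) ^ 2 := by positivity
    simpa using this
  · have : 0 < (c44 * K2 - R3 ^ 2) * y ^ 2 := by positivity
    nlinarith [sq_nonneg (c44 * x + R3 * y)]

lemma posDef_elasticMatrix (hc : 0 < c44) (hdet : 0 < c44 * K2 - R3 ^ 2) :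
    (elasticMatrix c44 R3 K2).PosDef := by
  refine Matrix.PosDef.of_dotProduct_mulVec_pos ?_ fun x hx => ?_
  · ext i j
    fin_cases i <;> fin_cases j <;> simp [elasticMatrix]
  · have hxy : x 0 ≠ 0 ∨ x 1 ≠ 0 := by
      by_contra! h
      exact hx (by ext i; fin_cases i <;> simp [h.1, h.2])
    have := quadratic_pos hc hdet hxy
    simp only [elasticMatrix, dotProduct, Matrix.mulVec, Fin.sum_univ_two, star_trivial,
      Matrix.of_apply, Matrix.cons_val_zero, Matrix.cons_val_one]
    nlinarith

lemma trace_elasticMatrix : (elasticMatrix c44 R3 K2).trace = c44 + K2 := by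
  simp [elasticMatrix, Matrix.trace_fin_two]

lemma det_elasticMatrix : (elasticMatrix c44 R3 K2).det = c44 * K2 - R3 ^ 2 := by
  simp [elasticMatrix, Matrix.det_fin_two]; ring

lemma discriminant_nonneg : 0 ≤ (c44 + K2) ^ 2 - 4 * (c44 * K2 - R3 ^ 2) := by
  nlinarith [sq_nonneg (c44 - K2), sq_nonneg R3]

lemma eig1_add_eig2 (C : Matrix (Fin 2) (Fin 2) ℝ) : eig1 C + eig2 C = C.trace := by
  rw [eig1, eig2]; ring

lemma eig1_mul_eig2 :
    eig1 (elasticMatrix c44 R3 K2) * eig2 (elasticMatrix c44 R3 K2) = c44 * K2 - R3 ^ 2 := by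
  have h := Real.sq_sqrt (discriminant_nonneg (c44 := c44) (R3 := R3) (K2 := K2))
  rw [eig1, eig2, trace_elasticMatrix, det_elasticMatrix]
  linear_combination -h / 4

lemma eig1_pos (hc : 0 < c44) (hK : 0 < K2) : 0 < eig1 (elasticMatrix c44 R3 K2) := by
  rw [eig1, trace_elasticMatrix]
  positivity

lemma eig2_pos (hc : 0 < c44) (hK : 0 < K2) (hdet : 0 < c44 * K2 - R3 ^ 2) :
    0 < eig2 (elasticMatrix c44 R3 K2) :=
  pos_of_mul_pos_right (eig1_mul_eig2.symm ▸ hdet) (eig1_pos hc hK).le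

/-- This fixes a sign: `arccos` always yields a nonnegative sine, which has to agree with `(a₁ -
c₄₄) / N`. -/
lemma le_eig1 : c44 ≤ eig1 (elasticMatrix c44 R3 K2) := by
  have h : c44 - K2 ≤ √((c44 + K2) ^ 2 - 4 * (c44 * K2 - R3 ^ 2)) :=
    Real.le_sqrt_of_sq_le (by nlinarith [sq_nonneg R3])
  rw [eig1, trace_elasticMatrix, det_elasticMatrix]
  linarith

lemma det_rotation (ψ : ℝ) : (rotation ψ).det = 1 := by
  rw [rotation, Matrix.det_fin_two_of]
  nlinarith [Real.sin_sq_add_cos_sq ψ]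

lemma diagonalizes_iff {C : Matrix (Fin 2) (Fin 2) ℝ} {ψ a1 a2 : ℝ} :
    Diagonalizes C ψ a1 a2 ↔ C * rotation ψ = rotation ψ * !![a1, 0; 0, a2] := by
  have hu : IsUnit (rotation ψ).det := by rw [det_rotation]; exact isUnit_one
  rw [Diagonalizes]
  constructor
  · intro h
    rw [← h, Matrix.mul_assoc, Matrix.mul_nonsing_inv_cancel_left _ _ hu]
  · intro h
    rw [Matrix.mul_assoc, h, Matrix.nonsing_inv_mul_cancel_left _ _ hu]

lemma diagonalizes_elasticMatrix_iff {ψ a1 a2 : ℝ} :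
    Diagonalizes (elasticMatrix c44 R3 K2) ψ a1 a2 ↔
      (c44 * Real.cos ψ + R3 * Real.sin ψ = a1 * Real.cos ψ ∧
        R3 * Real.cos ψ + K2 * Real.sin ψ = a1 * Real.sin ψ) ∧
      (-(c44 * Real.sin ψ) + R3 * Real.cos ψ = -(a2 * Real.sin ψ) ∧
        -(R3 * Real.sin ψ) + K2 * Real.cos ψ = a2 * Real.cos ψ) := by
  rw [diagonalizes_iff, ← Matrix.ext_iff]
  simp only [elasticMatrix, rotation, Matrix.mul_apply, Fin.forall_fin_two, Fin.sum_univ_two,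
    Matrix.of_apply, Matrix.cons_val_zero, Matrix.cons_val_one, Matrix.cons_val',
    Matrix.cons_val_fin_one]
  constructor
  · rintro ⟨⟨h1, h2⟩, h3, h4⟩
    refine ⟨⟨?_, ?_⟩, ?_, ?_⟩ <;> linarith
  · rintro ⟨⟨h1, h2⟩, h3, h4⟩
    refine ⟨⟨?_, ?_⟩, ?_, ?_⟩ <;> linarith

/-- Each `a_m` is the value of the positive definite quadratic form at the `m`-th column of the
rotation, a unit vector. -/
lemma Diagonalizes.pos (hc : 0 < c44) (hdet : 0 < c44 * K2 - R3 ^ 2) {ψ a1 a2 : ℝ}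
    (h : Diagonalizes (elasticMatrix c44 R3 K2) ψ a1 a2) : 0 < a1 ∧ 0 < a2 := by
  obtain ⟨⟨h1, h2⟩, h3, h4⟩ := diagonalizes_elasticMatrix_iff.mp h
  have hsc := Real.sin_sq_add_cos_sq ψ
  have hne : Real.cos ψ ≠ 0 ∨ Real.sin ψ ≠ 0 := by
    by_contra! hn
    rw [hn.1, hn.2] at hsc
    norm_num at hsc
  have p1 := quadratic_pos hc hdet hne
  have p2 := quadratic_pos hc hdet (x := -Real.sin ψ) (y := Real.cos ψ)
    (hne.symm.imp_left neg_ne_zero.mpr)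
  constructor
  · have e : a1 = c44 * Real.cos ψ ^ 2 + 2 * R3 * Real.cos ψ * Real.sin ψ
        + K2 * Real.sin ψ ^ 2 := by
      linear_combination -Real.cos ψ * h1 - Real.sin ψ * h2 - a1 * hsc
    rwa [e]
  · have e : a2 = c44 * (-Real.sin ψ) ^ 2 + 2 * R3 * (-Real.sin ψ) * Real.cos ψ
        + K2 * Real.cos ψ ^ 2 := by
      linear_combination Real.sin ψ * h3 - Real.cos ψ * h4 - a2 * hsc
    rwa [e]

/-- The vector `(R₃, a₁ - c₄₄)` is an eigenvector for `a₁`, and the angle is chosen so that its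
normalization is the first column of the rotation. The second column is orthogonal to it and belongs
to `a₂`. -/
lemma diagonalizes_rotationAngle (hR : R3 ≠ 0) :
    Diagonalizes (elasticMatrix c44 R3 K2) (rotationAngle c44 R3 K2)
      (eig1 (elasticMatrix c44 R3 K2)) (eig2 (elasticMatrix c44 R3 K2)) := by
  have hsum := eig1_add_eig2 (elasticMatrix c44 R3 K2)
  rw [trace_elasticMatrix] at hsum
  have hprod := eig1_mul_eig2 (c44 := c44) (R3 := R3) (K2 := K2)
  have hle := le_eig1 (c44 := c44) (R3 := R3) (K2 := K2)
  set a1 := eig1 (elasticMatrix c44 R3 K2) with ha1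
  set a2 := eig2 (elasticMatrix c44 R3 K2)
  have hN0 : 0 < (c44 - a1) ^ 2 + R3 ^ 2 := by positivity
  set N := √((c44 - a1) ^ 2 + R3 ^ 2) with hN
  have hNpos : 0 < N := Real.sqrt_pos.mpr hN0
  have hN2 : N ^ 2 = (c44 - a1) ^ 2 + R3 ^ 2 := Real.sq_sqrt hN0.le
  have habs : |R3 / N| ≤ 1 := by
    rw [abs_div, abs_of_pos hNpos, div_le_one hNpos]
    exact Real.abs_le_sqrt (by nlinarith [sq_nonneg (c44 - a1)])
  have hcos : Real.cos (rotationAngle c44 R3 K2) = R3 / N := by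
    rw [rotationAngle, ← ha1, ← hN, Real.cos_arccos (abs_le.mp habs).1 (abs_le.mp habs).2]
  have hsin : Real.sin (rotationAngle c44 R3 K2) = (a1 - c44) / N := by
    rw [rotationAngle, ← ha1, ← hN, Real.sin_arccos,
      show 1 - (R3 / N) ^ 2 = ((a1 - c44) / N) ^ 2 by field_simp; linarith]
    exact Real.sqrt_sq (div_nonneg (by linarith) hNpos.le)
  rw [diagonalizes_elasticMatrix_iff, hcos, hsin]
  have ha2 : a2 = c44 + K2 - a1 := by linarith
  rw [ha2] at hprod ⊢
  refine ⟨⟨?_, ?_⟩, ?_, ?_⟩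
  · field_simp; ring
  · field_simp; linarith
  · field_simp; linarith
  · field_simp; linarith

lemma diagonalizes_zero : Diagonalizes (elasticMatrix c44 0 K2) 0 c44 K2 := by
  rw [diagonalizes_elasticMatrix_iff]
  simp

end Material

/-! ### The profiles `K₀(-ikr) / (2πa)` -/

/-- The radial derivative of `profileK`. -/
def profileK' (ρ ω a r : ℝ) : ℂ :=
  Complex.I * (waveNumber ρ ω a : ℂ) / (2 * (Real.pi : ℂ) * (a : ℂ))
    * besselK1 (-Complex.I * (waveNumber ρ ω a : ℂ) * (r : ℂ))

section Profile

variable {ρ ω a : ℝ}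

lemma waveNumber_pos (hρ : 0 < ρ) (hω : 0 < ω) (ha : 0 < a) : 0 < waveNumber ρ ω a := by
  rw [waveNumber]; positivity

lemma waveNumber_sq_mul (hρ : 0 < ρ) (ha : 0 < a) : waveNumber ρ ω a ^ 2 * a = ρ * ω ^ 2 := by
  rw [waveNumber, mul_pow, Real.sq_sqrt (by positivity)]
  field_simp

lemma neg_I_mul_assoc (k r : ℝ) :
    -Complex.I * (k : ℂ) * (r : ℂ) = -Complex.I * ((k * r : ℝ) : ℂ) := by push_cast; ring

lemma profileK_eq_profileH (hρ : 0 < ρ) (hω : 0 < ω) (ha : 0 < a) {r : ℝ} (hr : 0 < r) :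
    profileK ρ ω a r = profileH ρ ω a r := by
  have hk := waveNumber_pos hρ hω ha
  have hpi : (Real.pi : ℂ) ≠ 0 := by exact_mod_cast Real.pi_ne_zero
  have ha' : (a : ℂ) ≠ 0 := by exact_mod_cast ha.ne'
  rw [profileK, profileH, neg_I_mul_assoc, besselK0_neg_I_mul (mul_pos hk hr)]
  push_cast
  field_simp
  ring

lemma profileK_eq_hankelRep (hρ : 0 < ρ) (hω : 0 < ω) (ha : 0 < a) {r : ℝ} (hr : 0 < r) :
    profileK ρ ω a r = ((1 / (2 * Real.pi * a) : ℝ) : ℂ) * hankelRep (waveNumber ρ ω a * r) := by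
  rw [profileK, neg_I_mul_assoc,
    besselK0_eq_hankelRep (mul_pos (waveNumber_pos hρ hω ha) hr)]
  push_cast; ring

lemma profileK'_eq_hankelRepDeriv (hρ : 0 < ρ) (hω : 0 < ω) (ha : 0 < a) {r : ℝ} (hr : 0 < r) :
    profileK' ρ ω a r = ((1 / (2 * Real.pi * a) : ℝ) : ℂ) *
      (waveNumber ρ ω a * hankelRepDeriv (waveNumber ρ ω a * r)) := by
  rw [profileK', neg_I_mul_assoc,
    ← I_mul_besselK1_eq (mul_pos (waveNumber_pos hρ hω ha) hr)]
  push_cast; ring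

lemma hasDerivAt_mul_left_ofReal (k r : ℝ) : HasDerivAt (fun r : ℝ => k * r) k r := by
  simpa using (hasDerivAt_id r).const_mul k

lemma hasDerivAt_profileK (hρ : 0 < ρ) (hω : 0 < ω) (ha : 0 < a) {r : ℝ} (hr : 0 < r) :
    HasDerivAt (profileK ρ ω a) (profileK' ρ ω a r) r := by
  have hkr := mul_pos (waveNumber_pos hρ hω ha) hr
  have h := ((hasDerivAt_hankelRep hkr).scomp r
    (hasDerivAt_mul_left_ofReal (waveNumber ρ ω a) r)).const_mul
    ((1 / (2 * Real.pi * a) : ℝ) : ℂ)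
  rw [Complex.real_smul] at h
  rw [profileK'_eq_hankelRepDeriv hρ hω ha hr]
  exact h.congr_of_eventuallyEq
    ((eventually_gt_nhds hr).mono fun s hs => profileK_eq_hankelRep hρ hω ha hs)

lemma hasDerivAt_mul_profileK' (hρ : 0 < ρ) (hω : 0 < ω) (ha : 0 < a) {r : ℝ} (hr : 0 < r) :
    HasDerivAt (fun r : ℝ => r * profileK' ρ ω a r)
      (-((waveNumber ρ ω a : ℂ) ^ 2 * (r * profileK ρ ω a r))) r := by
  have hkr := mul_pos (waveNumber_pos hρ hω ha) hr
  have h := ((hasDerivAt_mul_hankelRepDeriv hkr).scomp r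
    (hasDerivAt_mul_left_ofReal (waveNumber ρ ω a) r)).const_mul
    ((1 / (2 * Real.pi * a) : ℝ) : ℂ)
  refine (h.congr_of_eventuallyEq ((eventually_gt_nhds hr).mono fun s hs => ?_)).congr_deriv ?_
  · simp only [Function.comp]
    rw [profileK'_eq_hankelRepDeriv hρ hω ha hs]
    push_cast; ring
  · rw [profileK_eq_hankelRep hρ hω ha hr, Complex.real_smul]
    push_cast; ring

lemma tendsto_mul_profileK' (hρ : 0 < ρ) (hω : 0 < ω) (ha : 0 < a) :
    Tendsto (fun r : ℝ => r * profileK' ρ ω a r) (𝓝[>] 0) (𝓝 (-(1 / (2 * Real.pi * a)))) := by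
  have hk := waveNumber_pos hρ hω ha
  have h1 : Tendsto (fun r : ℝ => waveNumber ρ ω a * r) (𝓝[>] 0) (𝓝[>] 0) := by
    refine tendsto_nhdsWithin_iff.mpr ⟨?_, ?_⟩
    · have := ((continuous_const_mul (waveNumber ρ ω a)).tendsto 0).mono_left
        (nhdsWithin_le_nhds (s := Set.Ioi 0))
      simpa using this
    · filter_upwards [self_mem_nhdsWithin] with r hr using mul_pos hk hr
  have h2 := (tendsto_mul_hankelRepDeriv.comp h1).const_mul ((1 / (2 * Real.pi * a) : ℝ) : ℂ)
  have e : ((1 / (2 * Real.pi * a) : ℝ) : ℂ) * -1 = -(1 / (2 * Real.pi * a)) := by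
    push_cast; ring
  rw [e] at h2
  refine h2.congr' ?_
  filter_upwards [self_mem_nhdsWithin] with r hr
  rw [profileK'_eq_hankelRepDeriv hρ hω ha hr]
  simp only [Function.comp]
  push_cast; ring

/-- In the constant, `4` and `1/k` cover the bound `2 + 1/(kr)` for the profile, while `4` and `2k`
cover `2k + 2/r` for its derivative. -/
theorem isSingularProfile_profileK (hρ : 0 < ρ) (hω : 0 < ω) (ha : 0 < a) :
    IsSingularProfile (profileK ρ ω a) (profileK' ρ ω a) ((waveNumber ρ ω a : ℂ) ^ 2)
      (-(1 / (2 * Real.pi * a))) (1 / (2 * Real.pi * a) *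
        (4 + 1 / waveNumber ρ ω a + 2 * waveNumber ρ ω a)) where
  hasDerivAt _ hr := hasDerivAt_profileK hρ hω ha hr
  hasDerivAt_mul _ hr := hasDerivAt_mul_profileK' hρ hω ha hr
  norm_le r hr := by
    have hk := waveNumber_pos hρ hω ha
    have hb : 0 < 1 / (2 * Real.pi * a) := by positivity
    rw [profileK_eq_hankelRep hρ hω ha hr, norm_mul, Complex.norm_real,
      Real.norm_of_nonneg hb.le, mul_assoc (1 / (2 * Real.pi * a))]
    gcongr
    refine (norm_hankelRep_le_add (mul_pos hk hr)).trans ?_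
    have h1 : 0 < 1 / waveNumber ρ ω a := by positivity
    have h2 : 0 < r⁻¹ := inv_pos.mpr hr
    rw [show 1 / (waveNumber ρ ω a * r) = 1 / waveNumber ρ ω a * r⁻¹ by field_simp]
    nlinarith [mul_pos h1 h2, mul_pos hk h2]
  norm_deriv_le r hr := by
    have hk := waveNumber_pos hρ hω ha
    have hb : 0 < 1 / (2 * Real.pi * a) := by positivity
    rw [profileK'_eq_hankelRepDeriv hρ hω ha hr, norm_mul, Complex.norm_real,
      Real.norm_of_nonneg hb.le, mul_assoc (1 / (2 * Real.pi * a))]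
    gcongr
    rw [norm_mul, Complex.norm_real, Real.norm_of_nonneg hk.le]
    have h0 := mul_le_mul_of_nonneg_left (norm_hankelRepDeriv_le_add (mul_pos hk hr)) hk.le
    refine h0.trans ?_
    have h1 : 0 < 1 / waveNumber ρ ω a := by positivity
    have h2 : 0 < r⁻¹ := inv_pos.mpr hr
    rw [show waveNumber ρ ω a * (2 + 2 / (waveNumber ρ ω a * r))
      = 2 * waveNumber ρ ω a + 2 * r⁻¹ by field_simp]
    nlinarith [mul_pos h1 h2, mul_pos hk h2]
  tendsto := tendsto_mul_profileK' hρ hω ha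

/-- The factor `√r` against the decay `r^{-3/2}` leaves `1/r`. -/
lemma tendsto_sqrt_mul_profileK_sub (hρ : 0 < ρ) (hω : 0 < ω) (ha : 0 < a) :
    Tendsto (fun r : ℝ => (√r : ℂ) *
      (profileK' ρ ω a r - Complex.I * (waveNumber ρ ω a : ℂ) * profileK ρ ω a r)) atTop
      (𝓝 0) := by
  have hk := waveNumber_pos hρ hω ha
  set k := waveNumber ρ ω a with hkdef
  have hb : 0 < 1 / (2 * Real.pi * a) := by positivity
  have hlim : Tendsto (fun r : ℝ => 1 / (2 * Real.pi * a) * (k * (2 * (2 * k) ^ (-(3 / 2) : ℝ))) *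
      r ^ (-(1 : ℝ))) atTop (𝓝 0) := by
    have := (tendsto_rpow_neg_atTop (one_pos : (0 : ℝ) < 1)).const_mul
      (1 / (2 * Real.pi * a) * (k * (2 * (2 * k) ^ (-(3 / 2) : ℝ))))
    rwa [mul_zero] at this
  refine squeeze_zero_norm' ((eventually_gt_atTop 0).mono fun r hr => ?_) hlim
  have e : profileK' ρ ω a r - Complex.I * (k : ℂ) * profileK ρ ω a r
      = ((1 / (2 * Real.pi * a) : ℝ) : ℂ) *
        (k * (hankelRepDeriv (k * r) - Complex.I * hankelRep (k * r))) := by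
    rw [profileK'_eq_hankelRepDeriv hρ hω ha hr, profileK_eq_hankelRep hρ hω ha hr, ← hkdef]
    ring
  rw [e, norm_mul, norm_mul, norm_mul, Complex.norm_real, Complex.norm_real, Complex.norm_real,
    Real.norm_of_nonneg hb.le, Real.norm_of_nonneg hk.le, Real.norm_of_nonneg (Real.sqrt_nonneg r)]
  have h1 := norm_hankelRepDeriv_sub_le (mul_pos hk hr)
  have h2 : (2 * (k * r)) ^ (-(3 / 2) : ℝ) = (2 * k) ^ (-(3 / 2) : ℝ) * r ^ (-(3 / 2) : ℝ) := by
    rw [← mul_assoc, Real.mul_rpow (by positivity) hr.le]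
  have h3 : √r * r ^ (-(3 / 2) : ℝ) = r ^ (-(1 : ℝ)) := by
    rw [Real.sqrt_eq_rpow, ← Real.rpow_add hr]
    norm_num
  calc √r * (1 / (2 * Real.pi * a) *
        (k * ‖hankelRepDeriv (k * r) - Complex.I * hankelRep (k * r)‖))
      ≤ √r * (1 / (2 * Real.pi * a) * (k * (2 * (2 * (k * r)) ^ (-(3 / 2) : ℝ)))) := by gcongr
    _ = _ := by
      rw [h2, ← h3]; ring

end Profile

/-! ### Radial functions about the source point -/

lemma exists_hasFDerivAt_radial {g : ℝ → ℂ} {g' : ℂ} {x ξ : Plane} (hx : x ≠ ξ)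
    (hg : HasDerivAt g g' (dist x ξ)) :
    ∃ L : Plane →L[ℝ] ℂ, HasFDerivAt (fun y => g (dist y ξ)) L x ∧
      ∀ v, L v = ((inner ℝ (x - ξ) v / dist x ξ : ℝ) : ℂ) * g' := by
  have h0 : ‖x - ξ‖ ≠ 0 := norm_ne_zero_iff.mpr (sub_ne_zero.mpr hx)
  have h1 := (((hasFDerivAt_id x).sub_const ξ).norm_sq).sqrt (pow_ne_zero 2 h0)
  have h2 : HasFDerivAt (fun y => dist y ξ) _ x :=
    h1.congr_of_eventuallyEq (Eventually.of_forall fun y => by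
      simp [dist_eq_norm])
  refine ⟨_, hg.hasFDerivAt.comp x h2, fun v => ?_⟩
  simp only [id, Real.sqrt_sq (norm_nonneg _), dist_eq_norm]
  simp [inner_sub_left]
  field_simp

lemma inner_sub_single (x ξ : Plane) (j : Fin 2) :
    inner ℝ (x - ξ) (EuclideanSpace.single j (1 : ℝ)) = x j - ξ j := by
  simp [EuclideanSpace.inner_single_right]

section Solution

variable {ρ ω ψ a a1 a2 : ℝ} {x ξ : Plane} {α : Fin 2 → ℝ}

lemma hasFDerivAt_profileK_dist (hρ : 0 < ρ) (hω : 0 < ω) (ha : 0 < a) (hx : x ≠ ξ) :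
    ∃ L : Plane →L[ℝ] ℂ, HasFDerivAt (fun y => profileK ρ ω a (dist y ξ)) L x ∧
      (∀ j, L (EuclideanSpace.single j 1) = profileDeriv ρ ω a ξ x j) ∧
      L ((dist x ξ)⁻¹ • (x - ξ)) = profileK' ρ ω a (dist x ξ) := by
  have hd : 0 < dist x ξ := dist_pos.mpr hx
  obtain ⟨L, hL, hv⟩ := exists_hasFDerivAt_radial hx (hasDerivAt_profileK hρ hω ha hd)
  refine ⟨L, hL, fun j => ?_, ?_⟩
  · rw [hv, inner_sub_single, profileDeriv, profileK']
    ring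
  · rw [hv, inner_smul_right, real_inner_self_eq_norm_sq, ← dist_eq_norm,
      show (dist x ξ)⁻¹ * dist x ξ ^ 2 / dist x ξ = 1 by field_simp]
    simp

/-- This is the factorization `h = diag(p₁, p₂) Qᵀ`: row `m` is `p_m` times the `m`-th column of the
rotation. -/
lemma modalMatrix_apply (p : Fin 2 → ℂ) (m j : Fin 2) :
    modalMatrix ψ (p 0) (p 1) m j = rotationC ψ j m * p m := by
  fin_cases m <;> fin_cases j <;> simp [modalMatrix, rotationC, rotation]

lemma det_rotationC (ψ : ℝ) : (rotationC ψ).det = 1 := by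
  have := Complex.ofRealHom.map_det (rotation ψ)
  rw [det_rotation] at this
  exact this.symm.trans (map_one _)

lemma rotationC_inv_mul_vStar :
    (rotationC ψ)⁻¹ * vStar ρ ω ψ a1 a2 ξ x = hMatrix ρ ω ψ a1 a2 ξ x := by
  rw [vStar, Matrix.nonsing_inv_mul_cancel_left]
  rw [det_rotationC]; exact isUnit_one

lemma hMatrix_apply (m j : Fin 2) : hMatrix ρ ω ψ (α 0) (α 1) ξ x m j
    = rotationC ψ j m * profileK ρ ω (α m) (dist x ξ) :=
  modalMatrix_apply (fun m => profileK ρ ω (α m) (dist x ξ)) m j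

lemma hDeriv_apply (i m j : Fin 2) : hDeriv ρ ω ψ (α 0) (α 1) ξ x i m j
    = rotationC ψ j m * profileDeriv ρ ω (α m) ξ x i :=
  modalMatrix_apply (fun m => profileDeriv ρ ω (α m) ξ x i) m j

lemma vStar_apply (i j : Fin 2) : vStar ρ ω ψ (α 0) (α 1) ξ x i j
    = ∑ m, rotationC ψ i m * (rotationC ψ j m * profileK ρ ω (α m) (dist x ξ)) := by
  rw [vStar, Matrix.mul_apply]
  exact Finset.sum_congr rfl fun m _ => by rw [hMatrix_apply]

lemma hasFDerivAt_hMatrix (hρ : 0 < ρ) (hω : 0 < ω) (hα : ∀ m, 0 < α m) (hx : x ≠ ξ)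
    (m i : Fin 2) :
    ∃ L : Plane →L[ℝ] ℂ,
      HasFDerivAt (fun y => hMatrix ρ ω ψ (α 0) (α 1) ξ y m i) L x ∧
      ∀ j, L (EuclideanSpace.single j 1) = hDeriv ρ ω ψ (α 0) (α 1) ξ x j m i := by
  obtain ⟨L, hL, hj, -⟩ := hasFDerivAt_profileK_dist hρ hω (hα m) hx
  simp only [hMatrix_apply, hDeriv_apply]
  exact ⟨_, hL.const_mul (rotationC ψ i m), fun j => by simp [hj]⟩

lemma hasFDerivAt_vStar (hρ : 0 < ρ) (hω : 0 < ω) (hα : ∀ m, 0 < α m) (hx : x ≠ ξ)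
    (l i : Fin 2) :
    ∃ L : Plane →L[ℝ] ℂ,
      HasFDerivAt (fun y => vStar ρ ω ψ (α 0) (α 1) ξ y l i) L x ∧
      ∀ j, L (EuclideanSpace.single j 1)
        = (rotationC ψ * hDeriv ρ ω ψ (α 0) (α 1) ξ x j) l i := by
  choose L hL hj using fun m => hasFDerivAt_hMatrix (ψ := ψ) hρ hω hα hx m i
  simp only [vStar, Matrix.mul_apply]
  refine ⟨_, HasFDerivAt.fun_sum fun m _ => (hL m).const_mul (rotationC ψ l m), fun j => ?_⟩
  simp [hj]

/-- Entries of row `m` are constant multiples of one radial profile, so the limit in `r` pulls back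
along the distance to `ξ`; uniformity in the direction is automatic. -/
theorem sommerfeldRadiation_hMatrix (hρ : 0 < ρ) (hω : 0 < ω) (hα : ∀ m, 0 < α m)
    (m j : Fin 2) : SommerfeldRadiation (waveNumber ρ ω (α m)) ξ
      (fun x => hMatrix ρ ω ψ (α 0) (α 1) ξ x m j) := by
  have h := ((tendsto_sqrt_mul_profileK_sub hρ hω (hα m)).comp
    (tendsto_dist_right_cocompact_atTop ξ)).const_mul (rotationC ψ j m)
  rw [mul_zero] at h
  refine h.congr' ?_
  filter_upwards [(tendsto_dist_right_cocompact_atTop ξ).eventually_gt_atTop 0] with x hx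
  obtain ⟨L, hL, -, hr⟩ := hasFDerivAt_profileK_dist hρ hω (hα m) (dist_pos.mp hx)
  simp only [hMatrix_apply, Function.comp]
  rw [(hL.const_mul (rotationC ψ j m)).fderiv, _root_.smul_apply, hr, smul_eq_mul]
  ring

lemma sum_rotationC_mul (ψ : ℝ) (i j : Fin 2) :
    ∑ m, rotationC ψ i m * rotationC ψ j m = (1 : Matrix (Fin 2) (Fin 2) ℂ) i j := by
  have h := Complex.sin_sq_add_cos_sq (ψ : ℂ)
  fin_cases i <;> fin_cases j <;> simp [rotationC, rotation]
  · linear_combination h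
  · ring
  · ring
  · linear_combination h

lemma Diagonalizes.sum_mul_rotationC {C : Matrix (Fin 2) (Fin 2) ℝ}
    (h : Diagonalizes C ψ a1 a2) (i m : Fin 2) :
    ∑ l, (C i l : ℂ) * rotationC ψ l m = (![a1, a2] m : ℂ) * rotationC ψ i m := by
  have h1 := congrFun (congrFun (diagonalizes_iff.mp h) i) m
  simp only [Matrix.mul_apply] at h1
  have h2 := congrArg Complex.ofReal h1
  push_cast at h2
  simp only [rotationC, Matrix.map_apply]
  rw [h2]
  fin_cases m <;> simp [mul_comm]

lemma continuous_laplacian {φ : Plane → ℂ} (hφ : ContDiff ℝ 2 φ) :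
    Continuous (Laplacian.laplacian φ) := by
  rw [funext (laplacian_eq_sum_fderiv hφ)]
  refine continuous_finsetSum _ fun i _ => ?_
  have h1 : ContDiff ℝ 1 fun y => fderiv ℝ φ y (EuclideanSpace.single i 1) :=
    (hφ.fderiv_right (m := 1) (by norm_num)).clm_apply contDiff_const
  exact (h1.continuous_fderiv one_ne_zero).clm_apply continuous_const

lemma hasCompactSupport_laplacian {φ : Plane → ℂ} (hφ : ContDiff ℝ 2 φ)
    (hc : HasCompactSupport φ) : HasCompactSupport (Laplacian.laplacian φ) := by
  rw [funext (laplacian_eq_sum_fderiv hφ)]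
  simp only [Fin.sum_univ_two]
  exact ((hc.fderiv_apply ℝ _).fderiv_apply ℝ _).add ((hc.fderiv_apply ℝ _).fderiv_apply ℝ _)

lemma integral_vStar_mul (hρ : 0 < ρ) (hω : 0 < ω) (hα : ∀ m, 0 < α m) {χ : Plane → ℂ}
    (hχ : Continuous χ) (hχc : HasCompactSupport χ) (i j : Fin 2) :
    ∫ x, vStar ρ ω ψ (α 0) (α 1) ξ x i j * χ x
      = ∑ m, rotationC ψ i m * rotationC ψ j m * ∫ x, profileK ρ ω (α m) (dist x ξ) * χ x := by
  have hi : ∀ m, Integrable fun x => profileK ρ ω (α m) (dist x ξ) * χ x := fun m => by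
    simpa only [smul_eq_mul] using ((isSingularProfile_profileK hρ hω
      (hα m)).locallyIntegrable_dist ξ).integrable_smul_right_of_hasCompactSupport hχ hχc
  have e : ∀ x, vStar ρ ω ψ (α 0) (α 1) ξ x i j * χ x
      = ∑ m, rotationC ψ i m * rotationC ψ j m * (profileK ρ ω (α m) (dist x ξ) * χ x) := by
    intro x
    rw [vStar_apply, Finset.sum_mul]
    exact Finset.sum_congr rfl fun m _ => by ring
  simp_rw [e]
  rw [integral_finsetSum _ fun m _ => (hi m).const_mul _]
  exact Finset.sum_congr rfl fun m _ => integral_const_mul _ _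

lemma locallyIntegrable_vStar (hρ : 0 < ρ) (hω : 0 < ω) (hα : ∀ m, 0 < α m) (i j : Fin 2) :
    LocallyIntegrable (fun x => vStar ρ ω ψ (α 0) (α 1) ξ x i j) volume := by
  have h := fun m => ((isSingularProfile_profileK hρ hω
    (hα m)).locallyIntegrable_dist ξ).smul (rotationC ψ i m * rotationC ψ j m)
  convert! (h 0).add (h 1) using 1
  funext x
  rw [vStar_apply, Fin.sum_univ_two]
  simp only [Pi.add_apply, Pi.smul_apply, smul_eq_mul]
  ring

lemma integral_profileK_laplacian (hρ : 0 < ρ) (hω : 0 < ω) (ha : 0 < a) {φ : Plane → ℂ}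
    (hφ : ContDiff ℝ (⊤ : ℕ∞) φ) (hc : HasCompactSupport φ) :
    (a : ℂ) * (∫ x, profileK ρ ω a (dist x ξ) * Laplacian.laplacian φ x)
      + ρ * ω ^ 2 * ∫ x, profileK ρ ω a (dist x ξ) * φ x = -φ ξ := by
  have h := (isSingularProfile_profileK hρ hω ha).integral_laplacian hφ hc ξ
  have hk : (waveNumber ρ ω a : ℂ) ^ 2 * a = ρ * ω ^ 2 := by
    exact_mod_cast waveNumber_sq_mul (ω := ω) hρ ha
  have hpi : (Real.pi : ℂ) ≠ 0 := by exact_mod_cast Real.pi_ne_zero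
  have ha' : (a : ℂ) ≠ 0 := by exact_mod_cast ha.ne'
  have e : (a : ℂ) * (2 * Real.pi * -(1 / (2 * Real.pi * a)) * φ ξ) = -φ ξ := by
    field_simp
  rw [← e, ← h, ← hk]
  ring

/-- The hypothesis `hC` says that the columns of the rotation are eigenvectors. It replaces `C` by
`α m` on each mode, the scalar equation turns each mode into `-φ ξ`, and orthogonality of the
rotation sums the coefficients to the identity matrix. -/
theorem isFundamentalSolution_vStar (hρ : 0 < ρ) (hω : 0 < ω) (hα : ∀ m, 0 < α m)
    {C : Matrix (Fin 2) (Fin 2) ℝ}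
    (hC : ∀ i m, ∑ l, (C i l : ℂ) * rotationC ψ l m = (α m : ℂ) * rotationC ψ i m) :
    IsFundamentalSolution C ρ ω ξ (vStar ρ ω ψ (α 0) (α 1) ξ) := by
  refine ⟨locallyIntegrable_vStar hρ hω hα, fun φ hφ hc i j => ?_⟩
  have hφ2 : ContDiff ℝ 2 φ := contDiff_infty.mp hφ 2
  simp only [integral_vStar_mul hρ hω hα (continuous_laplacian hφ2)
    (hasCompactSupport_laplacian hφ2 hc), integral_vStar_mul hρ hω hα hφ.continuous hc]
  have h0 := integral_profileK_laplacian (ξ := ξ) hρ hω (hα 0) hφ hc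
  have h1 := integral_profileK_laplacian (ξ := ξ) hρ hω (hα 1) hφ hc
  have c0 := hC i 0
  have c1 := hC i 1
  have ho := sum_rotationC_mul ψ i j
  simp only [Fin.sum_univ_two] at c0 c1 ho ⊢
  rw [← ho]
  set I0 := ∫ x, profileK ρ ω (α 0) (dist x ξ) * Laplacian.laplacian φ x
  set I1 := ∫ x, profileK ρ ω (α 1) (dist x ξ) * Laplacian.laplacian φ x
  linear_combination rotationC ψ j 0 * I0 * c0 + rotationC ψ j 1 * I1 * c1
    + rotationC ψ i 0 * rotationC ψ j 0 * h0 + rotationC ψ i 1 * rotationC ψ j 1 * h1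

end Solution

end AntiPlaneQC

end

/-! ### Assembly of the main theorem -/

theorem mainTheorem1 (c44 R3 K2 ρ ω : ℝ) (hc : 0 < c44) (hK : 0 < K2)
    (hdet : 0 < c44 * K2 - R3 ^ 2) (hρ : 0 < ρ) (hω : 0 < ω) :
    -- the material matrix, its eigenvalues and its diagonalization by a rotation
    (AntiPlaneQC.elasticMatrix c44 R3 K2).PosDef ∧
    0 < AntiPlaneQC.eig1 (AntiPlaneQC.elasticMatrix c44 R3 K2) ∧
    0 < AntiPlaneQC.eig2 (AntiPlaneQC.elasticMatrix c44 R3 K2) ∧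
    (R3 ≠ 0 → AntiPlaneQC.Diagonalizes (AntiPlaneQC.elasticMatrix c44 R3 K2)
      (AntiPlaneQC.rotationAngle c44 R3 K2)
      (AntiPlaneQC.eig1 (AntiPlaneQC.elasticMatrix c44 R3 K2))
      (AntiPlaneQC.eig2 (AntiPlaneQC.elasticMatrix c44 R3 K2))) ∧
    (R3 = 0 → AntiPlaneQC.Diagonalizes (AntiPlaneQC.elasticMatrix c44 R3 K2) 0 c44 K2) ∧
    -- for every such diagonalization:
    ∀ ψ a1 a2 : ℝ, AntiPlaneQC.Diagonalizes (AntiPlaneQC.elasticMatrix c44 R3 K2) ψ a1 a2 →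
      0 < a1 ∧ 0 < a2 ∧
      ∀ ξ : AntiPlaneQC.Plane,
        -- `v* = Q h` is a fundamental solution
        AntiPlaneQC.IsFundamentalSolution (AntiPlaneQC.elasticMatrix c44 R3 K2) ρ ω ξ
          (AntiPlaneQC.vStar ρ ω ψ a1 a2 ξ) ∧
        -- its modal components `Q⁻¹ v*` are outgoing with wave numbers `k₁`, `k₂`
        (∀ j : Fin 2,
          AntiPlaneQC.SommerfeldRadiation (AntiPlaneQC.waveNumber ρ ω a1) ξ
            (fun x => ((AntiPlaneQC.rotationC ψ)⁻¹ * AntiPlaneQC.vStar ρ ω ψ a1 a2 ξ x) 0 j) ∧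
          AntiPlaneQC.SommerfeldRadiation (AntiPlaneQC.waveNumber ρ ω a2) ξ
            (fun x => ((AntiPlaneQC.rotationC ψ)⁻¹ * AntiPlaneQC.vStar ρ ω ψ a1 a2 ξ x) 1 j)) ∧
        ∀ x : AntiPlaneQC.Plane, x ≠ ξ →
          -- the form of `h` in terms of the Hankel function
          AntiPlaneQC.hMatrix ρ ω ψ a1 a2 ξ x
            = AntiPlaneQC.modalMatrix ψ (AntiPlaneQC.profileH ρ ω a1 (dist x ξ))
                (AntiPlaneQC.profileH ρ ω a2 (dist x ξ)) ∧
          -- first derivatives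
          (∀ l i : Fin 2,
            DifferentiableAt ℝ (fun y => AntiPlaneQC.hMatrix ρ ω ψ a1 a2 ξ y l i) x ∧
            DifferentiableAt ℝ (fun y => AntiPlaneQC.vStar ρ ω ψ a1 a2 ξ y l i) x ∧
            ∀ j : Fin 2,
              AntiPlaneQC.partialDeriv j (fun y => AntiPlaneQC.hMatrix ρ ω ψ a1 a2 ξ y l i) x
                = AntiPlaneQC.hDeriv ρ ω ψ a1 a2 ξ x j l i ∧
              AntiPlaneQC.partialDeriv j (fun y => AntiPlaneQC.vStar ρ ω ψ a1 a2 ξ y l i) x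
                = (AntiPlaneQC.rotationC ψ * AntiPlaneQC.hDeriv ρ ω ψ a1 a2 ξ x j) l i) ∧
          -- tractions
          ∀ (n : AntiPlaneQC.Plane) (i : Fin 2),
            AntiPlaneQC.phononTraction c44 R3 (AntiPlaneQC.vStar ρ ω ψ a1 a2 ξ) i n x
              = ∑ j : Fin 2,
                  ((c44 : ℂ) *
                      (AntiPlaneQC.rotationC ψ * AntiPlaneQC.hDeriv ρ ω ψ a1 a2 ξ x j) 0 i
                    + (R3 : ℂ) *
                      (AntiPlaneQC.rotationC ψ * AntiPlaneQC.hDeriv ρ ω ψ a1 a2 ξ x j) 1 i)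
                  * (n j : ℂ) ∧
            AntiPlaneQC.phasonTraction R3 K2 (AntiPlaneQC.vStar ρ ω ψ a1 a2 ξ) i n x
              = ∑ j : Fin 2,
                  ((R3 : ℂ) *
                      (AntiPlaneQC.rotationC ψ * AntiPlaneQC.hDeriv ρ ω ψ a1 a2 ξ x j) 0 i
                    + (K2 : ℂ) *
                      (AntiPlaneQC.rotationC ψ * AntiPlaneQC.hDeriv ρ ω ψ a1 a2 ξ x j) 1 i)
                  * (n j : ℂ) := by
  have hposdef := AntiPlaneQC.posDef_elasticMatrix (R3 := R3) hc hdet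
  refine ⟨hposdef, AntiPlaneQC.eig1_pos hc hK, AntiPlaneQC.eig2_pos hc hK hdet,
    AntiPlaneQC.diagonalizes_rotationAngle, ?_, ?_⟩
  · rintro rfl
    exact AntiPlaneQC.diagonalizes_zero
  intro ψ a1 a2 hD
  obtain ⟨ha1, ha2⟩ := hD.pos hc hdet
  have hα : ∀ m : Fin 2, 0 < (![a1, a2] : Fin 2 → ℝ) m := by
    intro m
    fin_cases m
    · exact ha1
    · exact ha2
  refine ⟨ha1, ha2, fun ξ => ⟨?_, ?_, ?_⟩⟩
  · exact AntiPlaneQC.isFundamentalSolution_vStar (α := ![a1, a2]) hρ hω hα hD.sum_mul_rotationC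
  · intro j
    simp only [AntiPlaneQC.rotationC_inv_mul_vStar]
    exact ⟨AntiPlaneQC.sommerfeldRadiation_hMatrix (α := ![a1, a2]) hρ hω hα 0 j,
      AntiPlaneQC.sommerfeldRadiation_hMatrix (α := ![a1, a2]) hρ hω hα 1 j⟩
  · intro x hx
    have hd : 0 < dist x ξ := dist_pos.mpr hx
    have hv : ∀ l i j : Fin 2, AntiPlaneQC.partialDeriv j
        (fun y => AntiPlaneQC.vStar ρ ω ψ a1 a2 ξ y l i) x
        = (AntiPlaneQC.rotationC ψ * AntiPlaneQC.hDeriv ρ ω ψ a1 a2 ξ x j) l i := by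
      intro l i j
      obtain ⟨L, hL, hj⟩ := AntiPlaneQC.hasFDerivAt_vStar (ψ := ψ) (α := ![a1, a2]) hρ hω hα hx l i
      exact (congrFun (congrArg DFunLike.coe hL.fderiv) _).trans (hj j)
    refine ⟨?_, ?_, ?_⟩
    · rw [AntiPlaneQC.hMatrix, AntiPlaneQC.profileK_eq_profileH hρ hω ha1 hd,
        AntiPlaneQC.profileK_eq_profileH hρ hω ha2 hd]
    · intro l i
      obtain ⟨L, hL, hj⟩ := AntiPlaneQC.hasFDerivAt_hMatrix (ψ := ψ) (α := ![a1, a2])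
        hρ hω hα hx l i
      obtain ⟨L', hL', -⟩ := AntiPlaneQC.hasFDerivAt_vStar (ψ := ψ) (α := ![a1, a2])
        hρ hω hα hx l i
      refine ⟨hL.differentiableAt, hL'.differentiableAt, fun j => ⟨?_, hv l i j⟩⟩
      exact (congrFun (congrArg DFunLike.coe hL.fderiv) _).trans (hj j)
    · intro n i
      simp only [AntiPlaneQC.phononTraction, AntiPlaneQC.phononStress,
        AntiPlaneQC.phasonTraction, AntiPlaneQC.phasonStress, hv, and_self]
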